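/- **Setting.** Consider an uncertain linear system $\dot x = A(z)x+B(z)u+E(z)w$, $y=C(z)x+D(z)u$ with $x\in\mathbb{R}^{n_x}$, $u\in\mathbb{R}^{n_u}$, $w\in\mathbb{R}^{n_w}$, $y\in\mathbb{R}^{n_y}$, whose real matrices are measurable functions of an uncertainty parameter $z\in\mathbb{R}^{n_z}$. For a gain $K\in\mathbb{R}^{n_u\times n_x}$ let $\Sigma_{z,K}$ be the closed loop with $u=Kx$, and let $G_{z,K}(s)=(C(z)+D(z)K)\,(sI-A(z)-B(z)K)^{-1}E(z)$. If all eigenvalues of $A(z)+B(z)K$ have negative real part, put $$H_2(\Sigma_{z,K})=\sqrt{\frac1{2\pi}\int_{-\infty}^{\infty}\mathrm{trace}\big(G_{z,K}(j\omega)G_{z,K}(j\omega)^*\big)\,d\omega},$$ and otherwise put $H_2(\Sigma_{z,K})=\infty$. Let $\boldsymbol z_1,\dots,\boldsymbol z_N$ be i.i.d. with an arbitrary distribution $\mathbb{P}_z$ on $\mathbb{R}^{n_z}$, collected in the list $\boldsymbol D$. **Synthesis algorithm.** For a finite list $T$ of values $z_i$, write $A_i=A(z_i)$, etc., and consider the program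 of minimizing $\gamma$ over $\gamma\in\mathbb{R}$, symmetric $P_i$ and $Z_i$, and $K$, subject to $$\begin{bmatrix}(A_i+B_iK)P_i+P_i(A_i+B_iK)^\top & P_i(C_i+D_iK)^\top\\ (C_i+D_iK)P_i & -I\end{bmatrix}\prec0,\qquad \begin{bmatrix}Z_i&E_i^\top\\E_i&P_i\end{bmatrix}\succ0,$$ $\mathrm{trace}(Z_i)<\gamma$, $P_i\succ0$, $Z_i\succ0$, $\gamma>0$, for all $z_i\in T$. A numerical solver (such as hifoo) for this program is modelled as an arbitrary map that sends $T$ to a gain or to no gain; no optimality or other property of the returned gain is required. Let $K(T)$ be the gain it returns if the program is feasible and a gain is returned, and $K(T)=0$ otherwise; $K(T)$ is assumed to depend measurably on the entries of $T$. Put $\bar H_2(T)=\max_{z_i\in T}H_2(\Sigma_{z_i,K(T)})\in[0,\infty]$ and $L(T)=(K(T),\bar H_2(T))$. **Pick-to-Learn (P2L).** On a list $D$, start with $T=\emptyset$ and $(K,\bar H_2)=(0,0)$. While some $z_i\in D\setminus T$ (difference of lists, with multiplicity) has $H_2(\Sigma_{z_i,K})>\bar H_2$, append to $T$ a point of $D\setminus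 T$ with the largest value of $H_2(\Sigma_{z_i,K})$, ties being broken by a pre-specified measurable total order on $\mathbb{R}^{n_z}$ (which may depend on the current $T$), and set $(K,\bar H_2)=L(T)$. On termination return the current $K(D)$, $\bar H_2(D)$ and $T=T(D)$. **Bound.** For $\delta\in(0,1)$ and $k=0,\dots,N-1$, let $\bar\varepsilon(k,\delta,N)$ be the unique $\varepsilon\in[k/N,1]$ with $$\frac{\delta}{N}\sum_{m=k}^{N-1}\frac{\binom mk}{\binom Nk}(1-\varepsilon)^{-(N-m)}=1,$$ and let $\bar\varepsilon(N,\delta,N)=1$. **Claim.** For every $\delta\in(0,1)$, with $R(D)=\mathbb{P}_z\{z: H_2(\Sigma_{z,K(D)})>\bar H_2(D)\}$, $$\mathbb{P}\big\{R(\boldsymbol D)\le\bar\varepsilon(|\boldsymbol T|,\delta,N)\big\}\ge1-\delta,$$ where $\boldsymbol T=T(\boldsymbol D)$; in particular, this event is measurable. -/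

import Mathlib

open MeasureTheory ProbabilityTheory
open scoped ENNReal

/-! ### The risk bound `epsBar` -/

/-- `Ψ_{k,δ}(ε) = (δ/N) ∑_{m=k}^{N-1} (binom(m,k) / binom(N,k)) (1-ε)^{-(N-m)}`. -/
noncomputable def riskPsi (k : ℕ) (δ : ℝ) (N : ℕ) (ε : ℝ) : ℝ :=
  δ / N * ∑ m ∈ Finset.Ico k N,
    ((m.choose k : ℝ) / (N.choose k : ℝ)) * ((1 - ε) ^ (N - m))⁻¹

theorem choose_le_pow_mul_choose {k N m : ℕ} (hkm : k ≤ m) (hmN : m ≤ N) (hN : 0 < N) :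
    (m.choose k : ℝ) ≤ (1 - (k : ℝ) / N) ^ (N - m) * (N.choose k : ℝ) := by
  obtain ⟨j, rfl⟩ := Nat.exists_eq_add_of_le hmN
  have hN' : (0 : ℝ) < ((m + j : ℕ) : ℝ) := by exact_mod_cast hN
  have hr : (0 : ℝ) ≤ 1 - (k : ℝ) / ((m + j : ℕ) : ℝ) := by
    rw [sub_nonneg, div_le_one hN']
    exact_mod_cast hkm.trans hmN
  have key : ∀ i, i ≤ j →
      (m.choose k : ℝ) ≤ (1 - (k : ℝ) / ((m + j : ℕ) : ℝ)) ^ i * ((m + i).choose k : ℝ) := by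
    intro i
    induction i with
    | zero => intro _; simp
    | succ i ih =>
      intro hi
      refine (ih (by omega)).trans ?_
      rw [pow_succ, mul_assoc]
      refine mul_le_mul_of_nonneg_left ?_ (pow_nonneg hr i)
      have h1 : ((m + i).choose k : ℝ) * ((m + i : ℕ) + 1)
          = ((m + i + 1).choose k : ℝ) * ((m + i : ℕ) + 1 - k) := by
        have h := Nat.choose_mul_succ_eq (m + i) k
        have h2 : ((m + i + 1 - k : ℕ) : ℝ) = ((m + i : ℕ) : ℝ) + 1 - k := by
          rw [Nat.cast_sub (by omega)]; push_cast; ring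
        rw [← h2]
        exact_mod_cast h
      have hpos : (0 : ℝ) < ((m + i : ℕ) : ℝ) + 1 := by positivity
      have h3 : ((m + i).choose k : ℝ)
          = (1 - (k : ℝ) / (((m + i : ℕ) : ℝ) + 1)) * ((m + i + 1).choose k : ℝ) := by
        field_simp
        linarith
      rw [h3]
      refine mul_le_mul_of_nonneg_right ?_ (by positivity)
      have h4 : ((m + i : ℕ) : ℝ) + 1 ≤ ((m + j : ℕ) : ℝ) := by
        exact_mod_cast (by omega : m + i + 1 ≤ m + j)
      have h5 := div_le_div_of_nonneg_left (Nat.cast_nonneg (α := ℝ) k) hpos h4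
      linarith
  have h := key j le_rfl
  simpa using h

theorem existsUnique_riskPsi {k N : ℕ} {δ : ℝ} (hk : k < N) (h0 : 0 < δ) (h1 : δ < 1) :
    ∃! ε : ℝ, ε ∈ Set.Icc ((k : ℝ) / N) 1 ∧ riskPsi k δ N ε = 1 := by
  have hN : 0 < N := by omega
  have hNr : (0 : ℝ) < N := by exact_mod_cast hN
  have hkr : (k : ℝ) < N := by exact_mod_cast hk
  have hck : (0 : ℝ) < (N.choose k : ℝ) := by exact_mod_cast Nat.choose_pos hk.le
  have hmono : StrictMonoOn (riskPsi k δ N) (Set.Iio 1) := by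
    intro a ha b hb hab
    simp only [Set.mem_Iio] at ha hb
    refine mul_lt_mul_of_pos_left ?_ (by positivity)
    refine Finset.sum_lt_sum_of_nonempty (by simpa using hk) fun m hm => ?_
    rw [Finset.mem_Ico] at hm
    have hc : (0 : ℝ) < (m.choose k : ℝ) := by exact_mod_cast Nat.choose_pos hm.1
    refine mul_lt_mul_of_pos_left ?_ (by positivity)
    refine inv_strictAnti₀ (pow_pos (by linarith) _) ?_
    exact pow_lt_pow_left₀ (by linarith) (by linarith) (by omega)
  have hone : riskPsi k δ N 1 = 0 := by
    unfold riskPsi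
    rw [Finset.sum_eq_zero, mul_zero]
    intro m hm
    rw [Finset.mem_Ico] at hm
    rw [sub_self, zero_pow (by omega)]
    simp
  have hcont : ContinuousOn (riskPsi k δ N) (Set.Iio 1) := by
    unfold riskPsi
    refine continuousOn_const.mul (continuousOn_finsetSum _ fun m _ => continuousOn_const.mul ?_)
    refine ContinuousOn.inv₀ (by fun_prop) fun x hx => pow_ne_zero _ ?_
    simp only [Set.mem_Iio] at hx
    linarith
  have hlow : riskPsi k δ N ((k : ℝ) / N) ≤ 1 := by
    have hb : ∑ m ∈ Finset.Ico k N, ((m.choose k : ℝ) / (N.choose k : ℝ))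
        * ((1 - (k : ℝ) / N) ^ (N - m))⁻¹ ≤ ∑ m ∈ Finset.Ico k N, (1 : ℝ) := by
      refine Finset.sum_le_sum fun m hm => ?_
      rw [Finset.mem_Ico] at hm
      have hr : (0 : ℝ) < 1 - (k : ℝ) / N := by
        rw [sub_pos, div_lt_one hNr]; exact hkr
      rw [← div_eq_mul_inv, div_div, div_le_one (by positivity), mul_comm]
      exact choose_le_pow_mul_choose hm.1 hm.2.le hN
    have hb2 : ∑ m ∈ Finset.Ico k N, (1 : ℝ) ≤ N := by
      simp only [Finset.sum_const, Nat.card_Ico, nsmul_eq_mul, mul_one]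
      exact_mod_cast Nat.sub_le N k
    unfold riskPsi
    calc _ ≤ δ / N * (N : ℝ) := mul_le_mul_of_nonneg_left (hb.trans hb2) (by positivity)
      _ = δ := by field_simp
      _ ≤ 1 := h1.le
  obtain ⟨e, he1, he2, he3⟩ : ∃ e : ℝ, (k : ℝ) / N ≤ e ∧ e < 1 ∧ 1 ≤ riskPsi k δ N e := by
    have hq : (0 : ℝ) < (N - k) / N := div_pos (by linarith) hNr
    have hq1 : (0 : ℝ) < δ / N * ((N - k) / N) := by positivity
    refine ⟨1 - δ / N * ((N - k) / N), ?_, by linarith, ?_⟩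
    · have hdN : δ / N ≤ 1 := by
        rw [div_le_one hNr]
        have : (1 : ℝ) ≤ N := by exact_mod_cast hN
        linarith
      have : δ / N * ((N - k) / N) ≤ 1 * ((N - k) / N) :=
        mul_le_mul_of_nonneg_right hdN hq.le
      have h' : ((N : ℝ) - k) / N = 1 - k / N := by field_simp
      linarith
    · have hmem : N - 1 ∈ Finset.Ico k N := by simp; omega
      have hterm : ((N - 1 : ℕ).choose k : ℝ) / (N.choose k : ℝ) = ((N : ℝ) - k) / N := by
        have h := Nat.choose_mul_succ_eq (N - 1) k
        have e1 : N - 1 + 1 = N := by omega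
        simp only [e1] at h
        rw [div_eq_div_iff hck.ne' hNr.ne', ← Nat.cast_sub hk.le]
        rw [mul_comm ((N - k : ℕ) : ℝ)]
        have h' : ((N - 1).choose k * (N - 1 + 1)) = N.choose k * (N - k) := by
          rw [e1]; exact h
        rw [e1] at h'
        exact_mod_cast h'
      have hs := Finset.single_le_sum (s := Finset.Ico k N)
        (f := fun m => ((m.choose k : ℝ) / (N.choose k : ℝ))
          * ((1 - (1 - δ / N * ((N - k) / N))) ^ (N - m))⁻¹)
        (fun m _ => by
          have : (0 : ℝ) ≤ 1 - (1 - δ / N * ((N - k) / N)) := by linarith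
          positivity) hmem
      have e2 : N - (N - 1) = 1 := by omega
      simp only [hterm, e2, pow_one] at hs
      unfold riskPsi
      refine le_trans ?_ (mul_le_mul_of_nonneg_left hs (by positivity))
      apply le_of_eq
      have hNk : (N : ℝ) - k ≠ 0 := by linarith
      rw [sub_sub_cancel]
      field_simp
  have hsub : Set.Icc ((k : ℝ) / N) e ⊆ Set.Iio 1 := fun x hx => lt_of_le_of_lt hx.2 he2
  obtain ⟨x, hx, hx1⟩ := intermediate_value_Icc he1 (hcont.mono hsub) ⟨hlow, he3⟩
  refine ⟨x, ⟨⟨hx.1, (hsub hx).le⟩, hx1⟩, ?_⟩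
  rintro y ⟨hy, hy1⟩
  have hy2 : y < 1 := by
    refine lt_of_le_of_ne hy.2 ?_
    rintro rfl
    rw [hone] at hy1
    exact zero_ne_one hy1
  exact hmono.injOn hy2 (hsub hx) (hy1.trans hx1.symm)

open Classical in
/-- `epsBar k δ N`: for `k < N` and `δ ∈ (0,1)`, the unique solution in `[k/N, 1]` of
`Ψ_{k,δ}(ε) = 1`; for `k = N` it is `1`. -/
noncomputable def epsBar (k : ℕ) (δ : ℝ) (N : ℕ) : ℝ :=
  if h : k < N ∧ 0 < δ ∧ δ < 1 then
    (existsUnique_riskPsi h.1 h.2.1 h.2.2).choose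
  else 1

/-! ### The Pick-to-Learn meta-algorithm -/

open Classical in
/-- The greatest element of a list for a total order `le` (`none` for the empty list). -/
noncomputable def greatest? {Z : Type*} (le : Z → Z → Prop) : List Z → Option Z
  | [] => none
  | z :: l =>
    match greatest? le l with
    | none => some z
    | some w => if le z w then some w else some z

open Classical in
/-- At most `n` passes of the loop of Pick-to-Learn on the dataset `D`, from the training list `T`
and the decision `h`. `L` is the synthesis algorithm, `sat h z` is the property to be certified,
and `le T h z z'` says that, when the current training list is `T` and the current decision is
`h`, the point `z'` is at least as unsatisfied as `z`. `D.diff T` is the sublist of `D` obtained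
by removing the elements of `T`, one occurrence for each occurrence in `T`. -/
noncomputable def p2lLoop {Z H : Type*} (L : List Z → H) (sat : H → Z → Prop)
    (le : List Z → H → Z → Z → Prop) (D : List Z) : ℕ → List Z → H → H × List Z
  | 0, T, h => (h, T)
  | n + 1, T, h =>
    if ∃ z ∈ D.diff T, ¬ sat h z then
      match greatest? (le T h) (D.diff T) with
      | none => (h, T)
      | some zbar => p2lLoop L sat le D n (T ++ [zbar]) (L (T ++ [zbar]))
    else (h, T)

/-- Pick-to-Learn: start from `T = ∅` and `h = h₀` and run the loop until no point of `D \ T`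
violates the property. Every pass moves one point of `D` into `T`, so `D.length` passes always
suffice (see `p2l_terminated`). The output is the pair `(h, T)`. -/
noncomputable def p2l {Z H : Type*} (L : List Z → H) (h₀ : H) (sat : H → Z → Prop)
    (le : List Z → H → Z → Z → Prop) (D : List Z) : H × List Z :=
  p2lLoop L sat le D D.length [] h₀

theorem greatest?_mem {Z : Type*} (le : Z → Z → Prop) :
    ∀ {l : List Z} {w : Z}, greatest? le l = some w → w ∈ l
  | [], w, h => by simp [greatest?] at h
  | z :: l, w, h => by
    unfold greatest? at h
    split at h
    · simp_all
    · rename_i v hv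
      have := greatest?_mem le hv
      split_ifs at h <;> simp_all

theorem greatest?_eq_none {Z : Type*} (le : Z → Z → Prop) {l : List Z}
    (h : greatest? le l = none) : l = [] := by
  cases l with
  | nil => rfl
  | cons z l =>
    unfold greatest? at h
    split at h
    · simp at h
    · split_ifs at h

/-- When Pick-to-Learn returns `(h, T)`, all points of `D \ T` satisfy the property for `h`. -/
theorem p2l_terminated {Z H : Type*} (L : List Z → H) (h₀ : H) (sat : H → Z → Prop)
    (le : List Z → H → Z → Z → Prop) (D : List Z) :
    ∀ z, (open Classical in z ∈ D.diff (p2l L h₀ sat le D).2) → sat (p2l L h₀ sat le D).1 z := by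
  classical
  have key : ∀ (n : ℕ) (T : List Z) (h : H), (D.diff T).length ≤ n →
      ∀ z ∈ D.diff (p2lLoop L sat le D n T h).2, sat (p2lLoop L sat le D n T h).1 z := by
    intro n
    induction n with
    | zero =>
      intro T h hl z hz
      rw [Nat.le_zero, List.length_eq_zero_iff] at hl
      simp only [p2lLoop] at hz
      rw [hl] at hz
      simp at hz
    | succ n ih =>
      intro T h hl
      unfold p2lLoop
      split_ifs with hc
      · split
        · rename_i hg
          have := greatest?_eq_none _ hg
          obtain ⟨z, hz, -⟩ := hc
          intro z' hz'
          convert absurd hz _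
          convert List.not_mem_nil
        · rename_i zbar hg
          apply ih
          have hm := greatest?_mem _ hg
          have hm' : zbar ∈ D.diff T := by convert hm
          rw [List.diff_append, List.diff_cons, List.diff_nil, List.length_erase_of_mem hm']
          omega
      · push Not at hc
        intro z hz
        exact hc z (by convert hz)
  intro z hz
  unfold p2l at hz ⊢
  refine key D.length [] h₀ (by simp) z ?_
  convert hz

/-! ### Uncertain linear systems and the `H₂` norm -/

/-- An uncertain linear time-invariant plant `ẋ = A(z) x + B(z) u + E(z) w`,
`y = C(z) x + D(z) u`, with uncertainty parameter `z ∈ ℝ^{nz}`. -/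
structure UncertainPlant (nz nx nu nw ny : ℕ) where
  A : (Fin nz → ℝ) → Matrix (Fin nx) (Fin nx) ℝ
  B : (Fin nz → ℝ) → Matrix (Fin nx) (Fin nu) ℝ
  C : (Fin nz → ℝ) → Matrix (Fin ny) (Fin nx) ℝ
  D : (Fin nz → ℝ) → Matrix (Fin ny) (Fin nu) ℝ
  E : (Fin nz → ℝ) → Matrix (Fin nx) (Fin nw) ℝ

/-- All matrix entries of the plant are measurable functions of the uncertainty parameter. -/
structure UncertainPlant.IsMeasurable {nz nx nu nw ny : ℕ}
    (sys : UncertainPlant nz nx nu nw ny) : Prop where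
  A : ∀ i j, Measurable fun z => sys.A z i j
  B : ∀ i j, Measurable fun z => sys.B z i j
  C : ∀ i j, Measurable fun z => sys.C z i j
  D : ∀ i j, Measurable fun z => sys.D z i j
  E : ∀ i j, Measurable fun z => sys.E z i j

namespace UncertainPlant

variable {nz nx nu nw ny : ℕ}

/-- The state matrix `A(z) + B(z) K` of the closed loop `Σ_{z,K}` obtained with `u = K x`. -/
noncomputable def closedLoopA (sys : UncertainPlant nz nx nu nw ny) (z : Fin nz → ℝ)
    (K : Matrix (Fin nu) (Fin nx) ℝ) : Matrix (Fin nx) (Fin nx) ℝ :=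
  sys.A z + sys.B z * K

/-- The output matrix `C(z) + D(z) K` of the closed loop `Σ_{z,K}`. -/
noncomputable def closedLoopC (sys : UncertainPlant nz nx nu nw ny) (z : Fin nz → ℝ)
    (K : Matrix (Fin nu) (Fin nx) ℝ) : Matrix (Fin ny) (Fin nx) ℝ :=
  sys.C z + sys.D z * K

/-- The closed loop is (asymptotically) stable: all complex eigenvalues of `A(z) + B(z) K` have
negative real part. -/
def IsStable (sys : UncertainPlant nz nx nu nw ny) (z : Fin nz → ℝ)
    (K : Matrix (Fin nu) (Fin nx) ℝ) : Prop :=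
  ∀ s ∈ spectrum ℂ ((sys.closedLoopA z K).map Complex.ofReal), s.re < 0

/-- The closed-loop transfer function from `w` to `y`,
`G_{z,K}(s) = (C + D K) (s I - (A + B K))⁻¹ E`. -/
noncomputable def transfer (sys : UncertainPlant nz nx nu nw ny) (z : Fin nz → ℝ)
    (K : Matrix (Fin nu) (Fin nx) ℝ) (s : ℂ) : Matrix (Fin ny) (Fin nw) ℂ :=
  (sys.closedLoopC z K).map Complex.ofReal
    * (s • (1 : Matrix (Fin nx) (Fin nx) ℂ) - (sys.closedLoopA z K).map Complex.ofReal)⁻¹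
    * (sys.E z).map Complex.ofReal

open Classical in
/-- The `H₂` norm of the closed loop: `√((1/2π) ∫ trace (G(jω) G(jω)*) dω)` if the closed loop is
stable, and `∞` if it is not. -/
noncomputable def h2Norm (sys : UncertainPlant nz nx nu nw ny) (z : Fin nz → ℝ)
    (K : Matrix (Fin nu) (Fin nx) ℝ) : ℝ≥0∞ :=
  if sys.IsStable z K then
    (ENNReal.ofReal (1 / (2 * Real.pi)) *
      ∫⁻ ω : ℝ, ENNReal.ofReal
        (Matrix.trace (sys.transfer z K (Complex.I * ω)
          * (sys.transfer z K (Complex.I * ω)).conjTranspose)).re) ^ (1 / 2 : ℝ)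
  else ∞

/-- `(γ, (Pᵢ), (Zᵢ), K)` is a feasible point of the bilinear matrix inequality program of `H₂`
synthesis over the points `zᵢ` of the list `T`. -/
structure BMIFeasible (sys : UncertainPlant nz nx nu nw ny) (T : List (Fin nz → ℝ)) (γ : ℝ)
    (P : Fin T.length → Matrix (Fin nx) (Fin nx) ℝ)
    (Z : Fin T.length → Matrix (Fin nw) (Fin nw) ℝ)
    (K : Matrix (Fin nu) (Fin nx) ℝ) : Prop where
  lyapunov : ∀ i, (-(Matrix.fromBlocks
      (sys.closedLoopA (T.get i) K * P i + P i * (sys.closedLoopA (T.get i) K).transpose)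
      (P i * (sys.closedLoopC (T.get i) K).transpose)
      (sys.closedLoopC (T.get i) K * P i)
      (-1 : Matrix (Fin ny) (Fin ny) ℝ))).PosDef
  schur : ∀ i, (Matrix.fromBlocks (Z i) (sys.E (T.get i)).transpose
      (sys.E (T.get i)) (P i)).PosDef
  trace_lt : ∀ i, (Z i).trace < γ
  posDef_P : ∀ i, (P i).PosDef
  posDef_Z : ∀ i, (Z i).PosDef
  pos : 0 < γ

open Classical in
/-- The gain synthesized from the list `T`. If the program over `T` is feasible, it is the gain
that the numerical solver returns; the solver is an arbitrary map, its answer need be neither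
optimal nor feasible. If the program is infeasible, or the solver returns no gain, it is `0`. -/
noncomputable def synthGain (sys : UncertainPlant nz nx nu nw ny)
    (solver : List (Fin nz → ℝ) → Option (Matrix (Fin nu) (Fin nx) ℝ))
    (T : List (Fin nz → ℝ)) : Matrix (Fin nu) (Fin nx) ℝ :=
  if ∃ γ P Z K, sys.BMIFeasible T γ P Z K then (solver T).getD 0 else 0

/-- The threshold of a gain `K` over the list `T`: the largest `H₂` norm that `K` induces over the
points of `T`. -/
noncomputable def maxH2 (sys : UncertainPlant nz nx nu nw ny) (T : List (Fin nz → ℝ))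
    (K : Matrix (Fin nu) (Fin nx) ℝ) : ℝ≥0∞ :=
  (T.map fun z => sys.h2Norm z K).foldr max 0

/-- The synthesis algorithm `L`: it returns the pair of the gain and the threshold. -/
noncomputable def synth (sys : UncertainPlant nz nx nu nw ny)
    (solver : List (Fin nz → ℝ) → Option (Matrix (Fin nu) (Fin nx) ℝ))
    (T : List (Fin nz → ℝ)) : Matrix (Fin nu) (Fin nx) ℝ × ℝ≥0∞ :=
  (sys.synthGain solver T, sys.maxH2 T (sys.synthGain solver T))

/-- The property to be certified for a decision `h = (K, H̄₂)`: `H₂(Σ_{z,K}) ≤ H̄₂`. -/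
def Sat (sys : UncertainPlant nz nx nu nw ny) (h : Matrix (Fin nu) (Fin nx) ℝ × ℝ≥0∞)
    (z : Fin nz → ℝ) : Prop :=
  sys.h2Norm z h.1 ≤ h.2

/-- The order by degree of dissatisfaction: a higher `H₂` norm is worse, and ties are broken by
the pre-specified rule `tie`, which may depend on the current training list `T`. -/
def DissatLE (sys : UncertainPlant nz nx nu nw ny)
    (tie : List (Fin nz → ℝ) → (Fin nz → ℝ) → (Fin nz → ℝ) → Prop)
    (T : List (Fin nz → ℝ)) (h : Matrix (Fin nu) (Fin nx) ℝ × ℝ≥0∞) (z z' : Fin nz → ℝ) : Prop :=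
  sys.h2Norm z h.1 < sys.h2Norm z' h.1 ∨ (sys.h2Norm z h.1 = sys.h2Norm z' h.1 ∧ tie T z z')

/-- Pick-to-Learn for `H₂` state-feedback design, initialized at `K = 0`, `H̄₂ = 0`. The output is
`((K(D), H̄₂(D)), T)`. -/
noncomputable def h2P2L (sys : UncertainPlant nz nx nu nw ny)
    (solver : List (Fin nz → ℝ) → Option (Matrix (Fin nu) (Fin nx) ℝ))
    (tie : List (Fin nz → ℝ) → (Fin nz → ℝ) → (Fin nz → ℝ) → Prop)
    (D : List (Fin nz → ℝ)) :
    (Matrix (Fin nu) (Fin nx) ℝ × ℝ≥0∞) × List (Fin nz → ℝ) :=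
  p2l (sys.synth solver) (0, 0) sys.Sat (sys.DissatLE tie) D

/-- The risk of `h = (K, H̄₂)`: the probability that the `H₂` norm of `Σ_{z,K}` exceeds `H̄₂`, for
a new draw `z` of the uncertainty. -/
noncomputable def risk (sys : UncertainPlant nz nx nu nw ny) (Pz : Measure (Fin nz → ℝ))
    (h : Matrix (Fin nu) (Fin nx) ℝ × ℝ≥0∞) : ℝ≥0∞ :=
  Pz {z | h.2 < sys.h2Norm z h.1}

end UncertainPlant

/-!
# A generalization bound for Pick-to-Learn in `H₂` state-feedback design

Fix the number `m` of data points and an injection `σ : Fin k ↪ Fin m`. Whether Pick-to-Learn picks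
exactly the positions `σ 0, σ 1, …` is a condition of a special form: the list `t` of the picked
points has to be self-consistent (`IsPickChain`), and every other point, separately, has to leave
the picking of `t` undisturbed (`IsIdle`). For independent points, the probability of this event is
therefore `∫ q(t) ^ (m - k)` over the self-consistent `t`, where `q(t)` is the probability that a
new point is idle for `t` (`measure_runSet`). If the run is almost surely unique, summing over `σ`
gives, for every `m`,
`∑ₖ m.descFactorial k * ∫ q(t) ^ (m - k) ≤ 1` (`tsum_descFactorial_mul_lintegral_le_one`).

A point that violates the property for the final decision is not idle, so a risk above
`ε = epsBar k δ N` forces `q(t) < 1 - ε`. For such `q`, the equation that defines `epsBar` says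
exactly that `N.descFactorial k * q ^ (N - k)`, the weight of a run on `N` points, is at most `δ`
times the average over `m = 0, …, N - 1` of the weights `m.descFactorial k * q ^ (m - k)`
(`descFactorial_mul_pow_le`). Integrating and summing over `k`, the probability of a risk above
`epsBar` is at most `δ` (`measure_exists_runSet_epsBar_lt_le`).

The run is unique when the data are distinct (`IsRun.unique`), which may fail with positive
probability if the law has atoms. In that case each point gets an independent uniform label, which
decides between equal points; forgetting the labels turns the almost surely unique run on the
labelled data into a run on the data (`IsRun.of_label`), and all runs on the data lead to the same
output (`p2l_eq_of_isRun`). The same description of the output by runs shows that the event in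
question is measurable.

For the `H₂` problem it remains to see that the `H₂` norm is a measurable function of the plant
parameter and the gain. The transfer function is rational in the matrix entries, and instability is
a countable union of closed conditions, each one asking for an eigenvalue in a compact part of the
closed right half-plane (`measurableSet_setOf_spectrum_re_neg`).
-/

/-! ### Runs of Pick-to-Learn on an indexed dataset -/

section Runs

variable {Y H : Type*}

/-- `IsPickChain dec sat le t`: Pick-to-Learn, run on the points of `t` alone, picks all of them, in
the order `t 0, t 1, …`. Here `dec T` is the decision held when the training list is `T`, and
`le T` is the order by which the next point is selected. -/
def IsPickChain (dec : List Y → H) (sat : H → Y → Prop) (le : List Y → Y → Y → Prop) {k : ℕ}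
    (t : Fin k → Y) : Prop :=
  ∀ i : Fin k, ¬ sat (dec ((List.ofFn t).take i)) (t i) ∧
    ∀ j, i < j → le ((List.ofFn t).take i) (t j) (t i)

/-- `IsIdle dec sat le t x`: adding the point `x` to the dataset `t` does not disturb the picking
of the points of `t`, because `x` never beats the next point of `t` and satisfies the property for
the final decision. -/
def IsIdle (dec : List Y → H) (sat : H → Y → Prop) (le : List Y → Y → Y → Prop) {k : ℕ}
    (t : Fin k → Y) (x : Y) : Prop :=
  (∀ i : Fin k, le ((List.ofFn t).take i) x (t i)) ∧ sat (dec (List.ofFn t)) x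

/-- `IsRun dec sat le y σ`: on the dataset `y`, Pick-to-Learn may pick the positions
`σ 0, …, σ (k - 1)` in this order and then stop. When `y` has repeated points, several `σ` can
describe the same list of picked points. -/
def IsRun (dec : List Y → H) (sat : H → Y → Prop) (le : List Y → Y → Y → Prop) {k m : ℕ}
    (y : Fin m → Y) (σ : Fin k ↪ Fin m) : Prop :=
  IsPickChain dec sat le (fun i => y (σ i)) ∧
    ∀ j, (∀ i, σ i ≠ j) → IsIdle dec sat le (fun i => y (σ i)) (y j)

variable {dec : List Y → H} {sat : H → Y → Prop} {le : List Y → Y → Y → Prop}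

theorem take_ofFn_congr {k k' n : ℕ} {t : Fin k → Y} {t' : Fin k' → Y} (hk : n ≤ k) (hk' : n ≤ k')
    (h : ∀ i (hi : i < n), t ⟨i, by omega⟩ = t' ⟨i, by omega⟩) :
    (List.ofFn t).take n = (List.ofFn t').take n := by
  refine List.ext_getElem (by simp [hk, hk']) fun i h1 h2 => ?_
  simp only [List.length_take, List.length_ofFn] at h1
  simpa using h i (by omega)

/-- At a given step of a run, every position not yet picked is dominated by the position picked. -/
theorem IsRun.le_pick (hle : ∀ T, IsLinearOrder Y (le T)) {k m : ℕ} {y : Fin m → Y}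
    {σ : Fin k ↪ Fin m} (h : IsRun dec sat le y σ) (i : Fin k) (j : Fin m)
    (hj : ∀ i' < i, σ i' ≠ j) :
    le ((List.ofFn fun i => y (σ i)).take i) (y j) (y (σ i)) := by
  by_cases hr : ∃ i', σ i' = j
  · obtain ⟨i', rfl⟩ := hr
    rcases lt_trichotomy i i' with h1 | rfl | h1
    · exact (h.1 i).2 i' h1
    · exact (hle _).toIsPartialOrder.toIsPreorder.toRefl.refl _
    · exact absurd rfl (hj i' h1)
  · push Not at hr
    exact (h.2 j hr).1 i

/-- On a dataset without repeated points, two runs agree as long as both go on. -/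
theorem IsRun.agree (hle : ∀ T, IsLinearOrder Y (le T)) {k k' m : ℕ} {y : Fin m → Y}
    (hy : Function.Injective y) {σ : Fin k ↪ Fin m} {σ' : Fin k' ↪ Fin m}
    (h : IsRun dec sat le y σ) (h' : IsRun dec sat le y σ') (n : ℕ) (hn : n < k) (hn' : n < k') :
    σ ⟨n, hn⟩ = σ' ⟨n, hn'⟩ := by
  induction n using Nat.strong_induction_on with
  | _ n ih =>
    have hT : (List.ofFn fun i => y (σ i)).take n = (List.ofFn fun i => y (σ' i)).take n :=
      take_ofFn_congr hn.le hn'.le fun i hi => by rw [ih i hi (by omega) (by omega)]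
    apply hy
    have h1 := h.le_pick hle ⟨n, hn⟩ (σ' ⟨n, hn'⟩) fun i hi he => by
      have hi' : (i : ℕ) < n := hi
      rw [show i = ⟨i, i.2⟩ from rfl, ih i hi' i.2 (by omega)] at he
      have := congrArg Fin.val (σ'.injective he)
      simp at this
      omega
    have h2 := h'.le_pick hle ⟨n, hn'⟩ (σ ⟨n, hn⟩) fun i hi he => by
      have hi' : (i : ℕ) < n := hi
      rw [show i = ⟨i, i.2⟩ from rfl, ← ih i hi' (by omega) i.2] at he
      have := congrArg Fin.val (σ.injective he)
      simp at this
      omega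
    simp only at h1 h2
    rw [← hT] at h2
    exact (hle _).toIsPartialOrder.toAntisymm.antisymm _ _ h2 h1

theorem IsRun.length_le (hle : ∀ T, IsLinearOrder Y (le T)) {k k' m : ℕ} {y : Fin m → Y}
    (hy : Function.Injective y) {σ : Fin k ↪ Fin m} {σ' : Fin k' ↪ Fin m}
    (h : IsRun dec sat le y σ) (h' : IsRun dec sat le y σ') : k' ≤ k := by
  by_contra! hk
  have hT : (List.ofFn fun i => y (σ i)) = (List.ofFn fun i => y (σ' i)).take k := by
    rw [← take_ofFn_congr (t := fun i => y (σ i)) le_rfl hk.le fun i hi => by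
      rw [h.agree hle hy h' i hi (by omega)], List.take_of_length_le (by simp)]
  refine (h'.1 ⟨k, hk⟩).1 ?_
  simp only
  rw [← hT]
  refine (h.2 _ fun i he => ?_).2
  rw [show i = ⟨i, i.2⟩ from rfl, h.agree hle hy h' i i.2 (by omega)] at he
  have := congrArg Fin.val (σ'.injective he)
  have := i.2
  simp_all

/-- On a dataset without repeated points, Pick-to-Learn has a single run. -/
theorem IsRun.unique (hle : ∀ T, IsLinearOrder Y (le T)) {m : ℕ} {y : Fin m → Y}
    (hy : Function.Injective y) {s s' : Σ k, Fin k ↪ Fin m}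
    (h : IsRun dec sat le y s.2) (h' : IsRun dec sat le y s'.2) : s = s' := by
  obtain ⟨k, σ⟩ := s
  obtain ⟨k', σ'⟩ := s'
  obtain rfl : k = k' := le_antisymm (h'.length_le hle hy h) (h.length_le hle hy h')
  congr 1
  ext i
  rw [h.agree hle hy h' i i.2 i.2]

theorem exists_greatest {ι : Type*} {r : Y → Y → Prop} (hr : IsLinearOrder Y r) (f : ι → Y)
    (s : Finset ι) (hs : s.Nonempty) : ∃ w ∈ s, ∀ z ∈ s, r (f z) (f w) := by
  induction hs using Finset.Nonempty.cons_induction with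
  | singleton a => exact ⟨a, by simp, by simpa using hr.toIsPartialOrder.toIsPreorder.toRefl.refl _⟩
  | cons a s ha hs ih =>
    obtain ⟨w, hw, h⟩ := ih
    rcases hr.toTotal.total (f a) (f w) with h1 | h1
    · exact ⟨w, by simp [hw], by simpa using ⟨h1, h⟩⟩
    · refine ⟨a, by simp, ?_⟩
      simp only [Finset.mem_cons, forall_eq_or_imp]
      exact ⟨hr.toIsPartialOrder.toIsPreorder.toRefl.refl _, fun z hz =>
        hr.toIsPartialOrder.toIsPreorder.toIsTrans.trans _ _ _ (h z hz) h1⟩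

/-- Every dataset has a run: pick a greatest remaining position until the property holds for all
the remaining ones. -/
theorem exists_isRun (hle : ∀ T, IsLinearOrder Y (le T))
    (hmono : ∀ T x x', le T x x' → ¬ sat (dec T) x → ¬ sat (dec T) x') {m : ℕ} (y : Fin m → Y) :
    ∃ (k : ℕ) (σ : Fin k ↪ Fin m), IsRun dec sat le y σ := by
  classical
  let PR : ℕ → Prop := fun k => ∃ σ : Fin k ↪ Fin m, ∀ i : Fin k,
    ¬ sat (dec ((List.ofFn fun i => y (σ i)).take i)) (y (σ i)) ∧
      ∀ j, (∀ i' < i, σ i' ≠ j) → le ((List.ofFn fun i => y (σ i)).take i) (y j) (y (σ i))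
  have hbd : ∀ k, PR k → k ≤ m := fun k ⟨σ, _⟩ => by
    simpa using Fintype.card_le_of_embedding σ
  have h0 : PR 0 := ⟨⟨Fin.elim0, fun i => i.elim0⟩, fun i => i.elim0⟩
  have hk : PR (Nat.findGreatest PR m) := Nat.findGreatest_spec (Nat.zero_le m) h0
  have hmax : ¬ PR (Nat.findGreatest PR m + 1) := fun h =>
    absurd (Nat.le_findGreatest (hbd _ h) h) (by omega)
  generalize Nat.findGreatest PR m = k at hk hmax
  obtain ⟨σ, hσ⟩ := hk
  refine ⟨k, σ, fun i => ⟨(hσ i).1, fun j hij => (hσ i).2 _ fun i' hi' he => ?_⟩, fun j hj =>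
    ⟨fun i => (hσ i).2 j fun i' _ => hj i', ?_⟩⟩
  · exact absurd (σ.injective he) (hi'.trans hij).ne
  · by_contra hsat
    obtain ⟨w, hw, hwmax⟩ := exists_greatest (hle (List.ofFn fun i => y (σ i))) y
      (Finset.univ.filter fun j => ∀ i, σ i ≠ j) ⟨j, by simpa using hj⟩
    simp only [Finset.mem_filter, Finset.mem_univ, true_and] at hw hwmax
    have hw' : w ∉ Set.range σ := by simpa using hw
    apply hmax
    have hT : ∀ n ≤ k, (List.ofFn fun i => y (Fin.Embedding.snoc σ hw' i)).take n
        = (List.ofFn fun i => y (σ i)).take n := fun n hn =>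
      take_ofFn_congr (by omega) hn fun i hi => by
        have : (⟨i, by omega⟩ : Fin (k + 1)) = Fin.castSucc ⟨i, by omega⟩ := rfl
        simp [Fin.Embedding.snoc, this, -Fin.castSucc_mk]
    refine ⟨Fin.Embedding.snoc σ hw', fun i => ?_⟩
    rw [hT i (by omega)]
    refine Fin.lastCases ?_ (fun i => ?_) i
    · rw [Fin.val_last, List.take_of_length_le (by simp)]
      have hs : Fin.Embedding.snoc σ hw' (Fin.last k) = w := by simp [Fin.Embedding.snoc]
      rw [hs]
      refine ⟨hmono _ _ _ (hwmax j hj) hsat, fun j' hj' => hwmax j' fun i => ?_⟩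
      have := hj' i.castSucc (Fin.castSucc_lt_last i)
      simpa [Fin.Embedding.snoc] using this
    · have hs : ∀ i, Fin.Embedding.snoc σ hw' (Fin.castSucc i) = σ i := by
        simp [Fin.Embedding.snoc]
      rw [hs]
      refine ⟨(hσ i).1, fun j' hj' => (hσ i).2 j' fun i' hi' => ?_⟩
      have := hj' i'.castSucc (by simpa using hi')
      rwa [hs] at this

end Runs

/-! ### The output of Pick-to-Learn along a run -/

theorem greatest?_eq_some {Z : Type*} {le : Z → Z → Prop} (hle : IsLinearOrder Z le) {l : List Z}
    {w : Z} (hw : w ∈ l) (hmax : ∀ z ∈ l, le z w) : greatest? le l = some w := by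
  have key : ∀ (l : List Z) (v : Z), greatest? le l = some v → ∀ z ∈ l, le z v := by
    intro l
    induction l with
    | nil => simp
    | cons a l ih =>
      intro v hv z hz
      unfold greatest? at hv
      split at hv
      · rename_i hg
        obtain rfl := greatest?_eq_none le hg
        simp only [Option.some.injEq] at hv
        simp only [List.mem_singleton] at hz
        subst hv hz
        exact hle.toIsPartialOrder.toIsPreorder.toRefl.refl _
      · rename_i u hu
        have hu' := ih u hu
        split_ifs at hv with hau <;> simp only [Option.some.injEq] at hv <;> subst hv <;>
          rcases List.mem_cons.1 hz with rfl | hz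
        · exact hau
        · exact hu' z hz
        · exact hle.toIsPartialOrder.toIsPreorder.toRefl.refl _
        · exact hle.toIsPartialOrder.toIsPreorder.toIsTrans.trans _ _ _ (hu' z hz)
            ((hle.toTotal.total _ _).resolve_left hau)
  cases hg : greatest? le l with
  | none => rw [greatest?_eq_none le hg] at hw; simp at hw
  | some v =>
    rw [hle.toIsPartialOrder.toAntisymm.antisymm _ _ (key l v hg w hw)
      (hmax v (greatest?_mem le hg))]

theorem append_diff_cancel_left {Z : Type*} [DecidableEq Z] (a b : List Z) :
    (a ++ b).diff a = b := by
  induction a with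
  | nil => simp
  | cons x a ih => simp [List.diff_cons, ih]

open Classical in
/-- The decision that Pick-to-Learn holds when its training list is `T`: the initial one as long
as `T` is empty, and afterwards the one synthesized from `T`. -/
noncomputable def heldDecision {Z H : Type*} (L : List Z → H) (h₀ : H) (T : List Z) : H :=
  if T = [] then h₀ else L T

/-- The loop of Pick-to-Learn, entered with the first `i` points of a chain `t` as its training
list, picks the remaining points of `t` and stops, provided that all other data are idle. -/
theorem p2lLoop_take_eq {Z H : Type*} {L : List Z → H} {h₀ : H} {sat : H → Z → Prop}
    {le : List Z → H → Z → Z → Prop}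
    (hle : ∀ T, IsLinearOrder Z (le T (heldDecision L h₀ T))) {D rest : List Z} {k : ℕ}
    {t : Fin k → Z} (hD : D.Perm (List.ofFn t ++ rest))
    (hchain : IsPickChain (heldDecision L h₀) sat (fun T => le T (heldDecision L h₀ T)) t)
    (hidle : ∀ x ∈ rest,
      IsIdle (heldDecision L h₀) sat (fun T => le T (heldDecision L h₀ T)) t x) :
    ∀ (n i : ℕ), i ≤ k → k ≤ n + i →
      p2lLoop L sat le D n ((List.ofFn t).take i) (heldDecision L h₀ ((List.ofFn t).take i))
        = (heldDecision L h₀ (List.ofFn t), List.ofFn t) := by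
  classical
  intro n
  induction n with
  | zero =>
    intro i hi hn
    rw [p2lLoop, List.take_of_length_le (by simp; omega)]
  | succ n ih =>
    intro i hi hn
    have hdiff : (D.diff ((List.ofFn t).take i)).Perm ((List.ofFn t).drop i ++ rest) := by
      refine (hD.diff_right _).trans (List.Perm.of_eq ?_)
      conv_lhs => rw [← List.take_append_drop i (List.ofFn t), List.append_assoc]
      rw [List.take_append_drop, append_diff_cancel_left]
    rcases hi.eq_or_lt with rfl | hi'
    · rw [List.drop_of_length_le (by simp), List.nil_append] at hdiff
      rw [List.take_of_length_le (by simp)] at hdiff ⊢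
      rw [p2lLoop, if_neg]
      push Not
      exact fun x hx => (hidle x (hdiff.mem_iff.1 hx)).2
    · have hget : ∀ j, (hj : j < k) → i ≤ j → t ⟨j, hj⟩ ∈ (List.ofFn t).drop i := fun j hj hij => by
        rw [List.mem_drop_iff_getElem]
        exact ⟨j - i, by simp; omega, by simp [Nat.add_sub_cancel' hij]⟩
      have hmem : t ⟨i, hi'⟩ ∈ D.diff ((List.ofFn t).take i) :=
        hdiff.mem_iff.2 (List.mem_append_left _ (hget i hi' le_rfl))
      have hg : greatest? (le ((List.ofFn t).take i) (heldDecision L h₀ ((List.ofFn t).take i)))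
          (D.diff ((List.ofFn t).take i)) = some (t ⟨i, hi'⟩) := by
        refine greatest?_eq_some (hle _) hmem fun x hx => ?_
        rcases List.mem_append.1 (hdiff.mem_iff.1 hx) with hx | hx
        · obtain ⟨j, hj, rfl⟩ := List.mem_drop_iff_getElem.1 hx
          simp only [List.length_ofFn] at hj
          simp only [List.getElem_ofFn]
          rcases Nat.eq_zero_or_pos j with rfl | hj0
          · exact (hle _).toIsPartialOrder.toIsPreorder.toRefl.refl _
          · exact (hchain ⟨i, hi'⟩).2 _ (by simp [Fin.lt_def]; omega)
        · exact (hidle x hx).1 ⟨i, hi'⟩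
      rw [p2lLoop, if_pos ⟨_, hmem, (hchain ⟨i, hi'⟩).1⟩, hg]
      have hT : (List.ofFn t).take i ++ [t ⟨i, hi'⟩] = (List.ofFn t).take (i + 1) := by
        rw [List.take_add_one]
        simp [hi']
      have hL : L ((List.ofFn t).take (i + 1))
          = heldDecision L h₀ ((List.ofFn t).take (i + 1)) := by
        rw [heldDecision, if_neg]
        rw [← hT]
        simp
      simp only
      rw [hT, hL]
      exact ih (i + 1) hi' (by omega)

theorem perm_ofFn_append_map_filter {Z : Type*} {k m : ℕ} (y : Fin m → Z) (σ : Fin k ↪ Fin m)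
    [DecidablePred fun j => ∀ i, σ i ≠ j] :
    (List.ofFn y).Perm ((List.ofFn fun i => y (σ i)) ++
      ((List.finRange m).filter fun j => ∀ i, σ i ≠ j).map y) := by
  have h : (List.finRange m).Perm
      (List.ofFn σ ++ (List.finRange m).filter fun j => ∀ i, σ i ≠ j) := by
    rw [List.perm_ext_iff_of_nodup (List.nodup_finRange m)]
    · intro j
      simpa [List.mem_ofFn, ← not_exists] using Classical.em _
    · refine List.Nodup.append (List.nodup_ofFn.2 σ.injective) ((List.nodup_finRange m).filter _) ?_
      intro j hj
      simp only [List.mem_ofFn] at hj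
      obtain ⟨i, rfl⟩ := hj
      simp
  have := h.map y
  rwa [List.map_append, List.map_ofFn, ← List.ofFn_eq_map] at this

/-- Along a run, Pick-to-Learn outputs the picked points and the decision held at the end. This
also covers datasets with repeated points. -/
theorem p2l_eq_of_isRun {Z H : Type*} {L : List Z → H} {h₀ : H} {sat : H → Z → Prop}
    {le : List Z → H → Z → Z → Prop}
    (hle : ∀ T, IsLinearOrder Z (le T (heldDecision L h₀ T))) {k m : ℕ} {y : Fin m → Z}
    {σ : Fin k ↪ Fin m}
    (h : IsRun (heldDecision L h₀) sat (fun T => le T (heldDecision L h₀ T)) y σ) :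
    p2l L h₀ sat le (List.ofFn y)
      = (heldDecision L h₀ (List.ofFn fun i => y (σ i)), List.ofFn fun i => y (σ i)) := by
  classical
  have hkm : k ≤ m := by simpa using Fintype.card_le_of_embedding σ
  have := p2lLoop_take_eq hle (perm_ofFn_append_map_filter y σ) h.1 (fun x hx => by
    obtain ⟨j, hj, rfl⟩ := List.mem_map.1 hx
    exact h.2 j (by simpa using hj)) m 0 (Nat.zero_le _) (by omega)
  rw [p2l, List.length_ofFn]
  simpa [heldDecision] using this

/-! ### The generalization bound for runs with independent points -/

section Bound

/-- The datasets of size `m` on which the positions `σ` carry a list of points in `V` and all the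
other points lie in the set `Q t` determined by that list `t`. -/
def runSet {Y : Type*} {k m : ℕ} (V : Set (Fin k → Y)) (Q : (Fin k → Y) → Set Y)
    (σ : Fin k ↪ Fin m) : Set (Fin m → Y) :=
  {y | (fun i => y (σ i)) ∈ V ∧ ∀ j, (∀ i, σ i ≠ j) → y j ∈ Q (fun i => y (σ i))}

variable {Y : Type*} [MeasurableSpace Y]

theorem measurePreserving_split {k m : ℕ} (μ : Measure Y) [IsProbabilityMeasure μ]
    (σ : Fin k ↪ Fin m) :
    MeasurePreserving (fun y : Fin m → Y =>
        ((fun i => y (σ i), fun j => y j) : (Fin k → Y) × ({j // ∀ i, σ i ≠ j} → Y)))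
      (Measure.pi fun _ => μ) ((Measure.pi fun _ => μ).prod (Measure.pi fun _ => μ)) := by
  classical
  let e : Fin k ⊕ {j // ∀ i, σ i ≠ j} ≃ Fin m := Equiv.ofBijective (Sum.elim σ Subtype.val) (by
    refine ⟨Function.Injective.sumElim σ.injective Subtype.val_injective fun i j => j.2 i, ?_⟩
    intro j
    by_cases h : ∃ i, σ i = j
    · obtain ⟨i, rfl⟩ := h
      exact ⟨Sum.inl i, rfl⟩
    · push Not at h
      exact ⟨Sum.inr ⟨j, h⟩, rfl⟩)
  exact (measurePreserving_sumPiEquivProdPi (fun _ => μ)).comp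
    (measurePreserving_piCongrLeft (fun _ => μ) e).symm

/-- Given the points at the positions `σ`, the remaining `m - k` points are independent, so each of
them contributes one factor `μ (Q t)`. -/
theorem measure_runSet {k m : ℕ} (μ : Measure Y) [IsProbabilityMeasure μ] (σ : Fin k ↪ Fin m)
    {V : Set (Fin k → Y)} (hV : MeasurableSet V) {Q : (Fin k → Y) → Set Y}
    (hQ : MeasurableSet {p : (Fin k → Y) × Y | p.2 ∈ Q p.1}) :
    Measure.pi (fun _ => μ) (runSet V Q σ)
      = ∫⁻ t in V, μ (Q t) ^ (m - k) ∂(Measure.pi fun _ => μ) := by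
  classical
  let S : Set ((Fin k → Y) × ({j // ∀ i, σ i ≠ j} → Y)) :=
    {p | p.1 ∈ V ∧ ∀ j, p.2 j ∈ Q p.1}
  have hS : MeasurableSet S := by
    have hS' : S = Prod.fst ⁻¹' V ∩
        ⋂ j, {p : (Fin k → Y) × ({j // ∀ i, σ i ≠ j} → Y) | p.2 j ∈ Q p.1} := by
      ext
      simp [S]
    rw [hS']
    refine (measurable_fst hV).inter ?_
    refine MeasurableSet.iInter fun j => ?_
    have hm : Measurable fun p : (Fin k → Y) × ({j // ∀ i, σ i ≠ j} → Y) => (p.1, p.2 j) := by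
      fun_prop
    exact hm hQ
  have hcard : Fintype.card {j // ∀ i, σ i ≠ j} = m - k := by
    have h1 := Fintype.card_subtype_compl (fun j => ∃ i, σ i = j)
    have h2 : Fintype.card {j // ∃ i, σ i = j} = k := by
      rw [← Nat.card_eq_fintype_card]
      exact (Nat.card_congr (Equiv.ofInjective σ σ.injective).symm).trans (Nat.card_fin k)
    rw [h2, Fintype.card_fin] at h1
    rw [← h1]
    exact Fintype.card_congr (Equiv.subtypeEquivRight fun j => by simp)
  have hpre : (runSet V Q σ)
      = (fun y : Fin m → Y =>
        ((fun i => y (σ i), fun j => y j) : (Fin k → Y) × ({j // ∀ i, σ i ≠ j} → Y))) ⁻¹' S := by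
    ext y
    simp [S, runSet]
  rw [hpre, (measurePreserving_split μ σ).measure_preimage hS.nullMeasurableSet,
    Measure.prod_apply hS, ← lintegral_indicator hV]
  refine lintegral_congr fun t => ?_
  by_cases ht : t ∈ V
  · have : Prod.mk t ⁻¹' S = Set.pi Set.univ fun _ => Q t := by
      ext w
      simp [S, ht]
    rw [this, Measure.pi_pi, Set.indicator_of_mem ht, Finset.prod_const, Finset.card_univ, hcard]
  · have : Prod.mk t ⁻¹' S = ∅ := by
      ext w
      simp [S, ht]
    rw [this, measure_empty, Set.indicator_of_notMem ht]

theorem measurableSet_runSet {k m : ℕ} (σ : Fin k ↪ Fin m)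
    {V : Set (Fin k → Y)} (hV : MeasurableSet V) {Q : (Fin k → Y) → Set Y}
    (hQ : MeasurableSet {p : (Fin k → Y) × Y | p.2 ∈ Q p.1}) :
    MeasurableSet (runSet V Q σ) := by
  have h1 : Measurable fun y : Fin m → Y => fun i => y (σ i) := by fun_prop
  have hS : runSet (m := m) V Q σ = (fun (y : Fin m → Y) i => y (σ i)) ⁻¹' V ∩
      ⋂ j, ⋂ _ : ∀ i, σ i ≠ j, {y | y j ∈ Q (fun i => y (σ i))} := by
    ext
    simp [runSet]
  rw [hS]
  refine (h1 hV).inter ?_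
  refine MeasurableSet.iInter fun j => MeasurableSet.iInter fun _ => ?_
  have hm : Measurable fun y : Fin m → Y => ((fun i => y (σ i) : Fin k → Y), y j) := by
    fun_prop
  exact hm hQ

theorem tsum_embedding_const (k m : ℕ) (c : ℝ≥0∞) :
    ∑' _ : Fin k ↪ Fin m, c = (m.descFactorial k : ℝ≥0∞) * c := by
  rw [tsum_fintype, Finset.sum_const, Finset.card_univ, Fintype.card_embedding_eq,
    Fintype.card_fin, Fintype.card_fin, nsmul_eq_mul]

/-- If almost every sample of size `m` has at most one run, the probabilities of the possible runs
sum to at most one. -/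
theorem tsum_descFactorial_mul_lintegral_le_one (μ : Measure Y) [IsProbabilityMeasure μ]
    {V : ∀ k, Set (Fin k → Y)} (hV : ∀ k, MeasurableSet (V k))
    {Q : ∀ k, (Fin k → Y) → Set Y}
    (hQ : ∀ k, MeasurableSet {p : (Fin k → Y) × Y | p.2 ∈ Q k p.1}) (m : ℕ)
    (huniq : ∀ᵐ y ∂(Measure.pi fun _ : Fin m => μ), ∀ s s' : Σ k, Fin k ↪ Fin m,
      y ∈ runSet (V s.1) (Q s.1) s.2 → y ∈ runSet (V s'.1) (Q s'.1) s'.2 → s = s') :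
    ∑' k, (m.descFactorial k : ℝ≥0∞) *
      ∫⁻ t in V k, μ (Q k t) ^ (m - k) ∂(Measure.pi fun _ => μ) ≤ 1 := by
  let A : (Σ k, Fin k ↪ Fin m) → Set (Fin m → Y) := fun s => runSet (V s.1) (Q s.1) s.2
  have hdisj : Pairwise (Function.onFun (AEDisjoint (Measure.pi fun _ : Fin m => μ)) A) := by
    intro s s' hne
    refine measure_mono_null ?_ huniq
    intro y hy
    simp only [Set.mem_compl_iff, Set.mem_ofPred_eq]
    exact fun h => hne (h s s' hy.1 hy.2)
  have := tsum_meas_le_meas_iUnion_of_disjoint₀ (Measure.pi fun _ : Fin m => μ)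
    (fun s : Σ k, Fin k ↪ Fin m =>
      (measurableSet_runSet s.2 (hV s.1) (hQ s.1)).nullMeasurableSet) hdisj
  calc _ = ∑' s, Measure.pi (fun _ : Fin m => μ) (A s) := by
        rw [ENNReal.tsum_sigma fun k (σ : Fin k ↪ Fin m) =>
          Measure.pi (fun _ => μ) (runSet (V k) (Q k) σ)]
        refine tsum_congr fun k => ?_
        rw [← tsum_embedding_const]
        exact tsum_congr fun σ => (measure_runSet μ σ (hV k) (hQ k)).symm
    _ ≤ _ := this
    _ ≤ 1 := prob_le_one

theorem epsBar_spec {k N : ℕ} {δ : ℝ} (hk : k < N) (h0 : 0 < δ) (h1 : δ < 1) :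
    epsBar k δ N ∈ Set.Icc ((k : ℝ) / N) 1 ∧ riskPsi k δ N (epsBar k δ N) = 1 := by
  rw [epsBar, dif_pos ⟨hk, h0, h1⟩]
  exact (existsUnique_riskPsi hk h0 h1).choose_spec.1

theorem epsBar_nonneg (k N : ℕ) (δ : ℝ) : 0 ≤ epsBar k δ N := by
  by_cases h : k < N ∧ 0 < δ ∧ δ < 1
  · exact le_trans (by positivity) (epsBar_spec h.1 h.2.1 h.2.2).1.1
  · rw [epsBar, dif_neg h]
    exact zero_le_one

/-- The defining equation of `epsBar`, as a comparison between the weight of a run on a sample of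
size `N` and its average weight over the smaller sample sizes. -/
theorem choose_mul_pow_le {k N : ℕ} {δ q : ℝ} (hk : k < N) (h0 : 0 < δ) (h1 : δ < 1) (hq : 0 ≤ q)
    (hqe : q < 1 - epsBar k δ N) :
    (N.choose k : ℝ) * q ^ (N - k)
      ≤ ∑ m ∈ Finset.Ico k N, δ / N * ((m.choose k : ℝ) * q ^ (m - k)) := by
  rcases hq.eq_or_lt with rfl | hq
  · rw [zero_pow (by omega), mul_zero]
    positivity
  have hc : (0 : ℝ) < N.choose k := by exact_mod_cast Nat.choose_pos hk.le
  have hspec := (epsBar_spec hk h0 h1).2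
  have h2 : (1 : ℝ) ≤ riskPsi k δ N (1 - q) := by
    refine hspec.ge.trans ?_
    unfold riskPsi
    refine mul_le_mul_of_nonneg_left (Finset.sum_le_sum fun m _ =>
      mul_le_mul_of_nonneg_left ?_ (by positivity)) (by positivity)
    refine inv_anti₀ (pow_pos (by linarith) _) (pow_le_pow_left₀ (by linarith) (by linarith) _)
  calc (N.choose k : ℝ) * q ^ (N - k) ≤ (N.choose k : ℝ) * q ^ (N - k) * riskPsi k δ N (1 - q) :=
        le_mul_of_one_le_right (by positivity) h2
    _ = _ := by
        unfold riskPsi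
        rw [Finset.mul_sum, Finset.mul_sum]
        refine Finset.sum_congr rfl fun m hm => ?_
        rw [Finset.mem_Ico] at hm
        have : q ^ (N - k) = q ^ (m - k) * q ^ (N - m) := by
          rw [← pow_add]
          congr 1
          omega
        rw [this, sub_sub_cancel]
        field_simp

theorem descFactorial_mul_pow_le {k N : ℕ} {δ : ℝ} {q : ℝ≥0∞} (h0 : 0 < δ) (h1 : δ < 1)
    (hk : k < N) (hqe : q + ENNReal.ofReal (epsBar k δ N) < 1) :
    (N.descFactorial k : ℝ≥0∞) * q ^ (N - k)
      ≤ ∑ m ∈ Finset.range N,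
        ENNReal.ofReal (δ / N) * ((m.descFactorial k : ℝ≥0∞) * q ^ (m - k)) := by
  have hq : q ≠ ∞ := ne_top_of_lt (lt_of_le_of_lt le_self_add hqe)
  lift q to NNReal using hq
  have hqe' : (q : ℝ) < 1 - epsBar k δ N := by
    have he := epsBar_nonneg k N δ
    have h := (ENNReal.toReal_lt_toReal (by simp) (by simp)).2 hqe
    rw [ENNReal.toReal_add (by simp) (by simp), ENNReal.toReal_ofReal he] at h
    simp at h
    linarith
  have key := choose_mul_pow_le hk h0 h1 q.coe_nonneg hqe'
  have hsub : Finset.Ico k N ⊆ Finset.range N := fun m hm => by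
    simp at hm ⊢
    omega
  refine le_trans ?_ (Finset.sum_le_sum_of_subset hsub)
  have hcast : ∀ m : ℕ, (m.descFactorial k : ℝ≥0∞) * (q : ℝ≥0∞) ^ (m - k)
      = ENNReal.ofReal (k.factorial * ((m.choose k : ℝ) * (q : ℝ) ^ (m - k))) := fun m => by
    rw [Nat.descFactorial_eq_factorial_mul_choose, ← mul_assoc,
      ENNReal.ofReal_mul (by positivity),
      ENNReal.ofReal_pow q.coe_nonneg, ENNReal.ofReal_coe_nnreal]
    norm_cast
  have hδ : 0 ≤ δ / N := by positivity
  simp only [hcast]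
  simp only [← ENNReal.ofReal_mul hδ]
  rw [← ENNReal.ofReal_sum_of_nonneg fun m _ => by positivity]
  refine ENNReal.ofReal_le_ofReal ?_
  refine (mul_le_mul_of_nonneg_left key (Nat.cast_nonneg k.factorial)).trans (le_of_eq ?_)
  rw [Finset.mul_sum]
  exact Finset.sum_congr rfl fun m _ => by ring

/-- **Generalization bound.** Suppose that almost every sample has at most one run, and that
whenever `t` is the list of picked points the risk `r t` is at most the probability that a new
point disturbs the run. Then the risk exceeds `epsBar` with probability at most `δ`. -/
theorem measure_exists_runSet_epsBar_lt_le (μ : Measure Y) [IsProbabilityMeasure μ]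
    {V : ∀ k, Set (Fin k → Y)} (hV : ∀ k, MeasurableSet (V k))
    {Q : ∀ k, (Fin k → Y) → Set Y}
    (hQ : ∀ k, MeasurableSet {p : (Fin k → Y) × Y | p.2 ∈ Q k p.1})
    (huniq : ∀ m, ∀ᵐ y ∂(Measure.pi fun _ : Fin m => μ), ∀ s s' : Σ k, Fin k ↪ Fin m,
      y ∈ runSet (V s.1) (Q s.1) s.2 → y ∈ runSet (V s'.1) (Q s'.1) s'.2 → s = s')
    {r : ∀ k, (Fin k → Y) → ℝ≥0∞} (hr : ∀ k, Measurable (r k))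
    (hrQ : ∀ k t, μ (Q k t) + r k t ≤ 1) (N : ℕ) {δ : ℝ} (h0 : 0 < δ) (h1 : δ < 1) :
    Measure.pi (fun _ => μ) {y : Fin N → Y |
        ∃ s : Σ k, Fin k ↪ Fin N, y ∈ runSet (V s.1) (Q s.1) s.2 ∧
        ENNReal.ofReal (epsBar s.1 δ N) < r s.1 (fun i => y (s.2 i))} ≤ ENNReal.ofReal δ := by
  let B : ∀ k, Set (Fin k → Y) := fun k => {t | ENNReal.ofReal (epsBar k δ N) < r k t}
  have hB : ∀ k, MeasurableSet (B k) := fun k => measurableSet_lt measurable_const (hr k)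
  have hqm : ∀ k, Measurable fun t => μ (Q k t) := fun k => measurable_measure_prodMk_left (hQ k)
  have hterm : ∀ k, (N.descFactorial k : ℝ≥0∞) *
        ∫⁻ t in V k ∩ B k, μ (Q k t) ^ (N - k) ∂(Measure.pi fun _ => μ)
      ≤ ∑ m ∈ Finset.range N, ENNReal.ofReal (δ / N) * ((m.descFactorial k : ℝ≥0∞) *
        ∫⁻ t in V k, μ (Q k t) ^ (m - k) ∂(Measure.pi fun _ => μ)) := by
    intro k
    have hlt : ∀ t ∈ B k, μ (Q k t) + ENNReal.ofReal (epsBar k δ N) < 1 := fun t ht =>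
      lt_of_lt_of_le (ENNReal.add_lt_add_left (measure_ne_top _ _) ht) (hrQ k t)
    rcases lt_or_ge k N with hk | hk
    · rw [← lintegral_const_mul _ ((hqm k).pow_const _)]
      calc _ ≤ ∫⁻ t in V k ∩ B k, ∑ m ∈ Finset.range N, ENNReal.ofReal (δ / N) *
              ((m.descFactorial k : ℝ≥0∞) * μ (Q k t) ^ (m - k)) ∂(Measure.pi fun _ => μ) :=
            setLIntegral_mono' ((hV k).inter (hB k)) fun t ht =>
              descFactorial_mul_pow_le h0 h1 hk (hlt t ht.2)
        _ ≤ ∫⁻ t in V k, ∑ m ∈ Finset.range N, ENNReal.ofReal (δ / N) *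
              ((m.descFactorial k : ℝ≥0∞) * μ (Q k t) ^ (m - k)) ∂(Measure.pi fun _ => μ) :=
            lintegral_mono_set Set.inter_subset_left
        _ = _ := by
            rw [lintegral_finsetSum _ fun m _ =>
              (((hqm k).pow_const _).const_mul _).const_mul _]
            refine Finset.sum_congr rfl fun m _ => ?_
            rw [lintegral_const_mul _ (((hqm k).pow_const _).const_mul _),
              lintegral_const_mul _ ((hqm k).pow_const _)]
    · -- for `k ≥ N` the bound `epsBar` is `1`, which no risk exceeds
      have : B k = ∅ := by
        refine Set.eq_empty_of_forall_notMem fun t ht => ?_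
        have := hlt t ht
        rw [epsBar, dif_neg (by omega), ENNReal.ofReal_one] at this
        exact absurd this (not_lt.2 le_add_self)
      simp [this]
  have hsub : {y : Fin N → Y |
        ∃ s : Σ k, Fin k ↪ Fin N, y ∈ runSet (V s.1) (Q s.1) s.2 ∧
        ENNReal.ofReal (epsBar s.1 δ N) < r s.1 (fun i => y (s.2 i))}
      ⊆ ⋃ s : Σ k, Fin k ↪ Fin N, runSet (V s.1 ∩ B s.1) (Q s.1) s.2 := by
    rintro y ⟨s, hs, hs'⟩
    exact Set.mem_iUnion.2 ⟨s, ⟨hs.1, hs'⟩, hs.2⟩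
  calc _ ≤ _ := measure_mono hsub
    _ ≤ _ := measure_iUnion_le _
    _ = ∑' k, (N.descFactorial k : ℝ≥0∞) *
          ∫⁻ t in V k ∩ B k, μ (Q k t) ^ (N - k) ∂(Measure.pi fun _ => μ) := by
        rw [ENNReal.tsum_sigma fun k (σ : Fin k ↪ Fin N) =>
          Measure.pi (fun _ => μ) (runSet (V k ∩ B k) (Q k) σ)]
        refine tsum_congr fun k => ?_
        rw [← tsum_embedding_const]
        exact tsum_congr fun σ => measure_runSet μ σ ((hV k).inter (hB k)) (hQ k)
    _ ≤ ∑' k, ∑ m ∈ Finset.range N, ENNReal.ofReal (δ / N) * ((m.descFactorial k : ℝ≥0∞) *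
          ∫⁻ t in V k, μ (Q k t) ^ (m - k) ∂(Measure.pi fun _ => μ)) :=
        ENNReal.tsum_le_tsum hterm
    _ = ∑ m ∈ Finset.range N, ENNReal.ofReal (δ / N) * ∑' k, ((m.descFactorial k : ℝ≥0∞) *
          ∫⁻ t in V k, μ (Q k t) ^ (m - k) ∂(Measure.pi fun _ => μ)) := by
        rw [Summable.tsum_finsetSum fun _ _ => ENNReal.summable]
        exact Finset.sum_congr rfl fun m _ => ENNReal.tsum_mul_left
    _ ≤ ∑ m ∈ Finset.range N, ENNReal.ofReal (δ / N) * 1 := by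
        gcongr with m
        exact tsum_descFactorial_mul_lintegral_le_one μ hV hQ m (huniq m)
    _ ≤ ENNReal.ofReal δ := by
        rw [Finset.sum_const, Finset.card_range, mul_one, nsmul_eq_mul]
        rcases Nat.eq_zero_or_pos N with rfl | hN
        · simp
        · rw [← ENNReal.ofReal_natCast, ← ENNReal.ofReal_mul (by positivity),
            mul_div_cancel₀ _ (by positivity)]

end Bound

/-! ### Measurability of runs -/

theorem take_ofFn_eq_ofFn {Y : Type*} {k : ℕ} (t : Fin k → Y) (i : Fin k) :
    (List.ofFn t).take i = List.ofFn fun j : Fin i => t (Fin.castLE i.2.le j) :=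
  List.ext_getElem (by simp [i.2.le]) fun n h1 h2 => by simp

section RunMeasurability

variable {Y H : Type*} [MeasurableSpace Y] {dec : List Y → H} {sat : H → Y → Prop}
  {le : List Y → Y → Y → Prop}

theorem measurableSet_isPickChain
    (hsat : ∀ k, MeasurableSet {p : (Fin k → Y) × Y | sat (dec (List.ofFn p.1)) p.2})
    (hle : ∀ k, MeasurableSet {p : (Fin k → Y) × Y × Y | le (List.ofFn p.1) p.2.1 p.2.2}) (k : ℕ) :
    MeasurableSet {t : Fin k → Y | IsPickChain dec sat le t} := by
  have h : {t : Fin k → Y | IsPickChain dec sat le t} = ⋂ i : Fin k,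
      ({t | sat (dec (List.ofFn fun j : Fin i => t (Fin.castLE i.2.le j))) (t i)}ᶜ ∩
        ⋂ j, ⋂ _ : i < j,
          {t | le (List.ofFn fun j : Fin i => t (Fin.castLE i.2.le j)) (t j) (t i)}) := by
    ext t
    simp [IsPickChain, take_ofFn_eq_ofFn]
  rw [h]
  refine MeasurableSet.iInter fun i => MeasurableSet.inter (MeasurableSet.compl ?_)
    (MeasurableSet.iInter fun j => MeasurableSet.iInter fun _ => ?_)
  · have hm : Measurable fun t : Fin k → Y =>
        ((fun j : Fin i => t (Fin.castLE i.2.le j)), t i) := by fun_prop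
    exact hm (hsat i)
  · have hm : Measurable fun t : Fin k → Y =>
        ((fun j : Fin i => t (Fin.castLE i.2.le j)), t j, t i) := by fun_prop
    exact hm (hle i)

theorem measurableSet_isIdle
    (hsat : ∀ k, MeasurableSet {p : (Fin k → Y) × Y | sat (dec (List.ofFn p.1)) p.2})
    (hle : ∀ k, MeasurableSet {p : (Fin k → Y) × Y × Y | le (List.ofFn p.1) p.2.1 p.2.2}) (k : ℕ) :
    MeasurableSet {p : (Fin k → Y) × Y | IsIdle dec sat le p.1 p.2} := by
  have h : {p : (Fin k → Y) × Y | IsIdle dec sat le p.1 p.2} = (⋂ i : Fin k,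
      {p | le (List.ofFn fun j : Fin i => p.1 (Fin.castLE i.2.le j)) p.2 (p.1 i)}) ∩
        {p | sat (dec (List.ofFn p.1)) p.2} := by
    ext t
    simp [IsIdle, take_ofFn_eq_ofFn]
  rw [h]
  refine MeasurableSet.inter (MeasurableSet.iInter fun i => ?_) (hsat k)
  have hm : Measurable fun p : (Fin k → Y) × Y =>
      ((fun j : Fin i => p.1 (Fin.castLE i.2.le j)), p.2, p.1 i) := by fun_prop
  exact hm (hle i)

theorem measurableSet_isRun
    (hsat : ∀ k, MeasurableSet {p : (Fin k → Y) × Y | sat (dec (List.ofFn p.1)) p.2})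
    (hle : ∀ k, MeasurableSet {p : (Fin k → Y) × Y × Y | le (List.ofFn p.1) p.2.1 p.2.2})
    {k m : ℕ} (σ : Fin k ↪ Fin m) :
    MeasurableSet {y : Fin m → Y | IsRun dec sat le y σ} :=
  measurableSet_runSet σ (V := {t | IsPickChain dec sat le t})
    (Q := fun t => {x | IsIdle dec sat le t x})
    (measurableSet_isPickChain hsat hle k) (measurableSet_isIdle hsat hle k)

end RunMeasurability

/-! ### Breaking ties between equal points by independent labels -/

/-- The lexicographic refinement of the order `le` by a label: labels are compared only when the
two points are equivalent for `le`, that is, equal when `le` is antisymmetric. -/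
def labelLE {Z U : Type*} [LE U] (le : Z → Z → Prop) (y y' : Z × U) : Prop :=
  le y.1 y'.1 ∧ (le y'.1 y.1 → y.2 ≤ y'.2)

theorem isLinearOrder_labelLE {Z U : Type*} [LinearOrder U] {le : Z → Z → Prop}
    (hle : IsLinearOrder Z le) : IsLinearOrder (Z × U) (labelLE le) where
  refl y := ⟨hle.toIsPartialOrder.toIsPreorder.toRefl.refl _, fun _ => le_rfl⟩
  trans a b c h1 h2 := by
    have tr := hle.toIsPartialOrder.toIsPreorder.toIsTrans.trans
    exact ⟨tr _ _ _ h1.1 h2.1, fun h => (h1.2 (tr _ _ _ h2.1 h)).trans (h2.2 (tr _ _ _ h h1.1))⟩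
  antisymm a b h1 h2 := Prod.ext (hle.toIsPartialOrder.toAntisymm.antisymm _ _ h1.1 h2.1)
    (le_antisymm (h1.2 h2.1) (h2.2 h1.1))
  total a b := by
    by_cases h1 : le a.1 b.1 <;> by_cases h2 : le b.1 a.1
    · rcases le_total a.2 b.2 with h | h
      · exact Or.inl ⟨h1, fun _ => h⟩
      · exact Or.inr ⟨h2, fun _ => h⟩
    · exact Or.inl ⟨h1, fun h => absurd h h2⟩
    · exact Or.inr ⟨h2, fun h => absurd h h1⟩
    · exact absurd (hle.toTotal.total a.1 b.1) (by tauto)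

/-- Forgetting the labels turns a run on the labelled points into a run on the points. -/
theorem IsRun.of_label {Z U H : Type*} [LE U] {dec : List Z → H} {sat : H → Z → Prop}
    {le : List Z → Z → Z → Prop} {k m : ℕ} {y : Fin m → Z × U} {σ : Fin k ↪ Fin m}
    (h : IsRun (fun T => dec (T.map Prod.fst)) (fun d x => sat d x.1)
      (fun T => labelLE (le (T.map Prod.fst))) y σ) :
    IsRun dec sat le (fun i => (y i).1) σ := by
  have hmap : ∀ n, ((List.ofFn fun i => y (σ i)).take n).map Prod.fst
      = (List.ofFn fun i => (y (σ i)).1).take n := fun n => by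
    rw [List.map_take, List.map_ofFn]
    rfl
  have hmap' : (List.ofFn fun i => y (σ i)).map Prod.fst = List.ofFn fun i => (y (σ i)).1 := by
    rw [List.map_ofFn]
    rfl
  refine ⟨fun i => ⟨?_, fun j hij => ?_⟩, fun j hj => ⟨fun i => ?_, ?_⟩⟩
  · rw [← hmap]
    exact (h.1 i).1
  · rw [← hmap]
    exact ((h.1 i).2 j hij).1
  · rw [← hmap]
    exact ((h.2 j hj).1 i).1
  · rw [← hmap']
    exact (h.2 j hj).2

theorem prod_setOf_fst_eq_snd {U : Type*} [MeasurableSpace U] [LinearOrder U] [TopologicalSpace U]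
    [OrderClosedTopology U] [SecondCountableTopology U] [OpensMeasurableSpace U]
    (ν : Measure U) [SFinite ν] [NullSingletonClass ν] : (ν.prod ν) {p | p.1 = p.2} = 0 := by
  rw [Measure.measure_prod_null (measurableSet_eq_fun measurable_fst measurable_snd)]
  refine Filter.Eventually.of_forall fun x => ?_
  have : Prod.mk x ⁻¹' {p : U × U | p.1 = p.2} = {x} := by
    ext z
    simp [eq_comm]
  exact (congrArg ν this).trans (measure_singleton x)

/-- Independent uniform labels are almost surely distinct. -/
theorem ae_injective_label {Z : Type*} [MeasurableSpace Z] (μ : Measure Z)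
    [IsProbabilityMeasure μ] (m : ℕ) :
    ∀ᵐ y ∂(Measure.pi fun _ : Fin m => μ.prod (volume : Measure unitInterval)),
      Function.Injective y := by
  have hne : ∀ i j : Fin m, i ≠ j →
      ∀ᵐ y ∂(Measure.pi fun _ : Fin m => μ.prod (volume : Measure unitInterval)),
        (y i).2 ≠ (y j).2 := by
    intro i j hij
    have hlabel : ∀ i : Fin m,
        (Measure.pi fun _ : Fin m => μ.prod (volume : Measure unitInterval)).map
          (fun y => (y i).2) = volume := fun i =>
      (measurePreserving_snd.comp (measurePreserving_eval _ i)).map_eq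
    have hind := (iIndepFun_pi (μ := fun _ : Fin m => μ.prod (volume : Measure unitInterval))
      (X := fun _ => Prod.snd) fun _ => measurable_snd.aemeasurable).indepFun hij
    have hm : ∀ i : Fin m, Measurable fun y : Fin m → Z × unitInterval => (y i).2 := by fun_prop
    rw [indepFun_iff_map_prod_eq_prod_map_map (hm i).aemeasurable (hm j).aemeasurable,
      hlabel, hlabel] at hind
    have h0 := prod_setOf_fst_eq_snd (volume : Measure unitInterval)
    rw [← hind, Measure.map_apply (by fun_prop)
      (measurableSet_eq_fun measurable_fst measurable_snd)] at h0
    exact measure_eq_zero_iff_ae_notMem.1 h0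
  have := ae_all_iff.2 fun i => ae_all_iff.2 fun j => ae_all_iff.2 (hne i j)
  filter_upwards [this] with y hy i j hij
  by_contra h
  exact hy i j h (by rw [hij])

/-! ### The generalization bound for Pick-to-Learn -/

/-- The samples with a run of small risk form a measurable set, being a countable union over the
possible positions of the picked points. -/
theorem measurableSet_isRun_and_risk_le {Z H : Type*} [MeasurableSpace Z] (μ : Measure Z)
    [IsProbabilityMeasure μ] {dec : List Z → H} {sat : H → Z → Prop} {le : List Z → Z → Z → Prop}
    (hsatm : ∀ k, MeasurableSet {p : (Fin k → Z) × Z | sat (dec (List.ofFn p.1)) p.2})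
    (hlem : ∀ k, MeasurableSet {p : (Fin k → Z) × Z × Z | le (List.ofFn p.1) p.2.1 p.2.2})
    (N : ℕ) (c : ℕ → ℝ≥0∞) :
    MeasurableSet {y : Fin N → Z | ∃ s : Σ k, Fin k ↪ Fin N, IsRun dec sat le y s.2 ∧
      μ {x | ¬ sat (dec (List.ofFn fun i => y (s.2 i))) x} ≤ c s.1} := by
  have : {y : Fin N → Z | ∃ s : Σ k, Fin k ↪ Fin N, IsRun dec sat le y s.2 ∧
    μ {x | ¬ sat (dec (List.ofFn fun i => y (s.2 i))) x} ≤ c s.1} =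
      ⋃ s : Σ k, Fin k ↪ Fin N, {y | IsRun dec sat le y s.2} ∩
      {y | μ {x | ¬ sat (dec (List.ofFn fun i => y (s.2 i))) x}
        ≤ c s.1} := by
    ext y
    simp
  rw [this]
  refine MeasurableSet.iUnion fun s => (measurableSet_isRun hsatm hlem s.2).inter
    (measurableSet_le ?_ measurable_const)
  exact (measurable_measure_prodMk_left (hsatm s.1).compl).comp (by fun_prop)

/-- With probability at most `δ`, a sample has no run of risk at most `epsBar`. The law may have
atoms: the bound for almost surely unique runs is applied to the points with independent uniform
labels. -/
theorem measure_forall_run_epsBar_lt_le {Z H : Type*} [MeasurableSpace Z] (μ : Measure Z)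
    [IsProbabilityMeasure μ] {dec : List Z → H} {sat : H → Z → Prop} {le : List Z → Z → Z → Prop}
    (hle : ∀ T, IsLinearOrder Z (le T))
    (hmono : ∀ T x x', le T x x' → ¬ sat (dec T) x → ¬ sat (dec T) x')
    (hsatm : ∀ k, MeasurableSet {p : (Fin k → Z) × Z | sat (dec (List.ofFn p.1)) p.2})
    (hlem : ∀ k, MeasurableSet {p : (Fin k → Z) × Z × Z | le (List.ofFn p.1) p.2.1 p.2.2})
    (N : ℕ) {δ : ℝ} (h0 : 0 < δ) (h1 : δ < 1) :
    Measure.pi (fun _ => μ) {y : Fin N → Z | ∃ s : Σ k, Fin k ↪ Fin N, IsRun dec sat le y s.2 ∧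
      μ {x | ¬ sat (dec (List.ofFn fun i => y (s.2 i))) x} ≤ ENNReal.ofReal (epsBar s.1 δ N)}ᶜ
      ≤ ENNReal.ofReal δ := by
  set G : Set (Fin N → Z) := {y | ∃ s : Σ k, Fin k ↪ Fin N, IsRun dec sat le y s.2 ∧
      μ {x | ¬ sat (dec (List.ofFn fun i => y (s.2 i))) x} ≤ ENNReal.ofReal (epsBar s.1 δ N)}
  let ν := μ.prod (volume : Measure unitInterval)
  let dec' : List (Z × unitInterval) → H := fun T => dec (T.map Prod.fst)
  let sat' : H → Z × unitInterval → Prop := fun d x => sat d x.1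
  let le' : List (Z × unitInterval) → Z × unitInterval → Z × unitInterval → Prop :=
    fun T => labelLE (le (T.map Prod.fst))
  have hle' : ∀ T, IsLinearOrder _ (le' T) := fun T => isLinearOrder_labelLE (hle _)
  have hrm : ∀ k, Measurable fun t : Fin k → Z => μ {x | ¬ sat (dec (List.ofFn t)) x} :=
    fun k => measurable_measure_prodMk_left (hsatm k).compl
  have hsatm' : ∀ k, MeasurableSet {p : (Fin k → Z × unitInterval) × (Z × unitInterval) |
      sat' (dec' (List.ofFn p.1)) p.2} := fun k => by
    have hm : Measurable fun p : (Fin k → Z × unitInterval) × (Z × unitInterval) =>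
      ((fun i => (p.1 i).1), p.2.1) := by fun_prop
    convert hm (hsatm k) using 1
    ext p
    simp [sat', dec', List.map_ofFn, Function.comp_def]
  have hlem' : ∀ k, MeasurableSet {p : (Fin k → Z × unitInterval) × (Z × unitInterval) ×
      (Z × unitInterval) | le' (List.ofFn p.1) p.2.1 p.2.2} := fun k => by
    have hm : Measurable fun p : (Fin k → Z × unitInterval) × (Z × unitInterval) ×
      (Z × unitInterval) => ((fun i => (p.1 i).1), p.2.1.1, p.2.2.1) := by fun_prop
    have hm' : Measurable fun p : (Fin k → Z × unitInterval) × (Z × unitInterval) ×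
      (Z × unitInterval) => ((fun i => (p.1 i).1), p.2.2.1, p.2.1.1) := by fun_prop
    have hu : MeasurableSet {p : (Fin k → Z × unitInterval) × (Z × unitInterval) ×
      (Z × unitInterval) | p.2.1.2 ≤ p.2.2.2} := measurableSet_le (by fun_prop) (by fun_prop)
    convert (hm (hlem k)).inter ((hm' (hlem k)).compl.union hu) using 1
    ext p
    simp [le', labelLE, List.map_ofFn, Function.comp_def, imp_iff_not_or]
  have hbound := measure_exists_runSet_epsBar_lt_le ν
    (V := fun k => {t | IsPickChain dec' sat' le' t})
    (Q := fun k t => {x | IsIdle dec' sat' le' t x})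
    (measurableSet_isPickChain hsatm' hlem') (measurableSet_isIdle hsatm' hlem')
    (fun m => by
      filter_upwards [ae_injective_label μ m] with y hy s s' h h'
      exact IsRun.unique hle' hy h h')
    (r := fun k t => μ {x | ¬ sat (dec (List.ofFn fun i => (t i).1)) x})
    (fun k => (hrm k).comp (by fun_prop))
    (fun k t => by
      -- a point which violates the property for the final decision is not idle
      have hS : MeasurableSet {x | sat (dec (List.ofFn fun i => (t i).1)) x} :=
        measurable_prodMk_left (hsatm k)
      have hQ : ν {x | IsIdle dec' sat' le' t x}
          ≤ μ {x | sat (dec (List.ofFn fun i => (t i).1)) x} := by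
        rw [← (measurePreserving_fst (μ := μ) (ν := (volume : Measure unitInterval))).measure_preimage
          hS.nullMeasurableSet]
        refine measure_mono fun x hx => ?_
        have := hx.2
        simpa [sat', dec', List.map_ofFn, Function.comp_def] using this
      refine (add_le_add_left hQ _).trans (le_of_eq ?_)
      rw [← measure_univ (μ := μ), ← measure_add_measure_compl hS]
      rfl)
    N h0 h1
  have hG : MeasurableSet G :=
    measurableSet_isRun_and_risk_le μ hsatm hlem N fun k => ENNReal.ofReal (epsBar k δ N)
  have hpi : (Measure.pi fun _ : Fin N => μ) = (Measure.pi fun _ => ν).map fun y i => (y i).1 := by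
    have hfst : ν.map Prod.fst = μ := measurePreserving_fst.map_eq
    have := Measure.pi_map_pi (μ := fun _ : Fin N => ν) (f := fun _ => Prod.fst)
      (hμ := fun _ => by rw [hfst]; infer_instance) fun _ => measurable_fst.aemeasurable
    rw [this, hfst]
  rw [hpi, Measure.map_apply (by fun_prop) hG.compl]
  refine (measure_mono fun y hy => ?_).trans hbound
  obtain ⟨k, σ, hσ⟩ := exists_isRun hle' (dec := dec') (sat := sat')
    (fun T x x' h => hmono _ _ _ h.1) y
  refine ⟨⟨k, σ⟩, hσ, ?_⟩
  by_contra hr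
  exact hy ⟨⟨k, σ⟩, hσ.of_label, not_lt.1 hr⟩

/-- **Pick-to-Learn generalization bound.** For independent data with an arbitrary common law, the
probability that a new point violates the property for the output of Pick-to-Learn is at most
`epsBar` of the number of picked points, with confidence `1 - δ`. -/
theorem p2l_risk_le_epsBar {Z H Ω : Type*} [MeasurableSpace Z] [MeasurableSpace Ω] (P : Measure Ω)
    [IsProbabilityMeasure P] (μ : Measure Z) [IsProbabilityMeasure μ] {N : ℕ} (z : Fin N → Ω → Z)
    (hz : ∀ i, Measurable (z i)) (hlaw : ∀ i, P.map (z i) = μ) (hindep : iIndepFun z P)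
    {L : List Z → H} {h₀ : H} {sat : H → Z → Prop} {le : List Z → H → Z → Z → Prop}
    (hle : ∀ T, IsLinearOrder Z (le T (heldDecision L h₀ T)))
    (hmono : ∀ T h x x', le T h x x' → ¬ sat h x → ¬ sat h x')
    (hsatm : ∀ k, MeasurableSet
      {p : (Fin k → Z) × Z | sat (heldDecision L h₀ (List.ofFn p.1)) p.2})
    (hlem : ∀ k, MeasurableSet {p : (Fin k → Z) × Z × Z |
      le (List.ofFn p.1) (heldDecision L h₀ (List.ofFn p.1)) p.2.1 p.2.2})
    {δ : ℝ} (h0 : 0 < δ) (h1 : δ < 1) :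
    MeasurableSet {ω : Ω | μ {x | ¬ sat (p2l L h₀ sat le (List.ofFn fun i => z i ω)).1 x} ≤
        ENNReal.ofReal (epsBar (p2l L h₀ sat le (List.ofFn fun i => z i ω)).2.length δ N)} ∧
    ENNReal.ofReal (1 - δ) ≤
      P {ω : Ω | μ {x | ¬ sat (p2l L h₀ sat le (List.ofFn fun i => z i ω)).1 x} ≤
        ENNReal.ofReal (epsBar (p2l L h₀ sat le (List.ofFn fun i => z i ω)).2.length δ N)} := by
  let dec := heldDecision L h₀
  let le' : List Z → Z → Z → Prop := fun T => le T (dec T)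
  have hmono' : ∀ T x x', le' T x x' → ¬ sat (dec T) x → ¬ sat (dec T) x' := fun T => hmono T (dec T)
  let G : Set (Fin N → Z) := {y | ∃ s : Σ k, Fin k ↪ Fin N, IsRun dec sat le' y s.2 ∧
      μ {x | ¬ sat (dec (List.ofFn fun i => y (s.2 i))) x} ≤ ENNReal.ofReal (epsBar s.1 δ N)}
  have hG : MeasurableSet G :=
    measurableSet_isRun_and_risk_le μ (le := le') hsatm hlem N
      fun k => ENNReal.ofReal (epsBar k δ N)
  have hzm : Measurable fun ω i => z i ω := measurable_pi_lambda _ hz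
  have hpre : {ω : Ω | μ {x | ¬ sat (p2l L h₀ sat le (List.ofFn fun i => z i ω)).1 x} ≤
        ENNReal.ofReal (epsBar (p2l L h₀ sat le (List.ofFn fun i => z i ω)).2.length δ N)}
      = (fun ω i => z i ω) ⁻¹' G := by
    ext ω
    constructor
    · intro h
      obtain ⟨k, σ, hσ⟩ := exists_isRun hle hmono' fun i => z i ω
      refine ⟨⟨k, σ⟩, hσ, ?_⟩
      rw [Set.mem_ofPred_eq, p2l_eq_of_isRun hle hσ] at h
      simpa using h
    · rintro ⟨⟨k, σ⟩, hσ, h⟩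
      rw [Set.mem_ofPred_eq, p2l_eq_of_isRun hle hσ]
      simpa using h
  rw [hpre]
  refine ⟨hzm hG, ?_⟩
  have hpi : P.map (fun ω i => z i ω) = Measure.pi fun _ => μ := by
    rw [(iIndepFun_iff_map_fun_eq_pi_map fun i => (hz i).aemeasurable).1 hindep]
    simp only [hlaw]
  have hbad := measure_forall_run_epsBar_lt_le μ hle hmono' hsatm hlem N h0 h1
  rw [← Measure.map_apply hzm hG, hpi, ENNReal.ofReal_sub _ h0.le, ENNReal.ofReal_one,
    tsub_le_iff_right, ← measure_univ (μ := Measure.pi fun _ : Fin N => μ),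
    ← measure_add_measure_compl hG]
  exact add_le_add_right hbad _

/-! ### Measurability of the `H₂` norm -/

section MatrixMeasurability

variable {α : Type*} [MeasurableSpace α] {R : Type*} [CommRing R] [MeasurableSpace R]
  [MeasurableAdd₂ R] [MeasurableMul₂ R] {l m n : Type*} [Fintype m]

theorem measurable_matrix_mul_apply {A : α → Matrix l m R} {B : α → Matrix m n R}
    (hA : ∀ i j, Measurable fun a => A a i j) (hB : ∀ i j, Measurable fun a => B a i j) (i : l)
    (j : n) : Measurable fun a => (A a * B a) i j := by
  simp only [Matrix.mul_apply]
  exact Finset.measurable_fun_sum _ fun x _ => (hA i x).mul (hB x j)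

variable [DecidableEq m] {A : α → Matrix m m ℂ}

theorem measurable_matrix_det (hA : ∀ i j, Measurable fun a => A a i j) :
    Measurable fun a => (A a).det := by
  simp only [Matrix.det_apply]
  exact Finset.measurable_fun_sum _ fun σ _ =>
    (Finset.measurable_fun_prod _ fun i _ => hA (σ i) i).const_smul _

theorem measurable_matrix_inv_apply (hA : ∀ i j, Measurable fun a => A a i j) (i j : m) :
    Measurable fun a => (A a)⁻¹ i j := by
  simp only [Matrix.inv_def, Matrix.smul_apply, Ring.inverse_eq_inv', Matrix.adjugate_apply,
    smul_eq_mul]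
  refine (measurable_matrix_det hA).inv.mul (measurable_matrix_det fun i' j' => ?_)
  simp only [Matrix.updateRow_apply]
  split_ifs
  · exact measurable_const
  · exact hA i' j'

/-- The matrices with an eigenvalue in a given compact set form a closed set, by projection along
that compact set. -/
theorem isClosed_setOf_exists_det_eq_zero {K : Set ℂ} (hK : IsCompact K) :
    IsClosed {M : m → m → ℂ | ∃ s ∈ K, (s • (1 : Matrix m m ℂ) - Matrix.of M).det = 0} := by
  have := isCompact_iff_compactSpace.1 hK
  have hcl : IsClosed {p : K × (m → m → ℂ) |
      ((p.1 : ℂ) • (1 : Matrix m m ℂ) - Matrix.of p.2).det = 0} := by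
    refine isClosed_eq (Continuous.matrix_det ?_) continuous_const
    refine Continuous.sub ?_ ?_
    · exact (continuous_subtype_val.comp continuous_fst).smul continuous_const
    · exact continuous_snd
  have := isClosedMap_snd_of_compactSpace _ hcl
  convert this using 1
  ext M
  simp

/-- The matrices with an eigenvalue in the closed right half-plane form a countable union of closed
sets, because the half-plane is a countable union of compact sets. -/
theorem measurableSet_setOf_spectrum_re_neg (hA : ∀ i j, Measurable fun a => A a i j) :
    MeasurableSet {a | ∀ s ∈ spectrum ℂ (A a), s.re < 0} := by
  have hA' : Measurable fun a => (fun i j => A a i j : m → m → ℂ) :=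
    measurable_pi_lambda _ fun i => measurable_pi_lambda _ fun j => hA i j
  have h : {a | ∀ s ∈ spectrum ℂ (A a), s.re < 0} = (⋃ N : ℕ,
      (fun a => (fun i j => A a i j : m → m → ℂ)) ⁻¹'
        {M : m → m → ℂ | ∃ s ∈ Metric.closedBall (0 : ℂ) N ∩ {s | 0 ≤ s.re},
          (s • (1 : Matrix m m ℂ) - Matrix.of M).det = 0})ᶜ := by
    ext a
    have hs : ∀ s, s ∈ spectrum ℂ (A a) ↔ (s • (1 : Matrix m m ℂ) - A a).det = 0 := fun s => by
      rw [spectrum.mem_iff, Algebra.algebraMap_eq_smul_one, Matrix.isUnit_iff_isUnit_det,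
        isUnit_iff_ne_zero, not_not]
    simp only [Set.mem_ofPred_eq, Set.mem_compl_iff, Set.mem_iUnion, Set.mem_preimage, hs]
    constructor
    · rintro h ⟨N, s, ⟨-, hs0⟩, hdet⟩
      exact absurd (h s hdet) (not_lt.2 hs0)
    · intro h s hdet
      by_contra! hs0
      obtain ⟨N, hN⟩ := exists_nat_ge ‖s‖
      exact h ⟨N, s, ⟨by simpa using hN, hs0⟩, hdet⟩
  rw [h]
  refine (MeasurableSet.iUnion fun N => hA' (IsClosed.measurableSet ?_)).compl
  exact isClosed_setOf_exists_det_eq_zero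
    ((isCompact_closedBall _ _).inter_right (isClosed_le continuous_const Complex.continuous_re))

end MatrixMeasurability

namespace UncertainPlant

variable {nz nx nu nw ny : ℕ} {sys : UncertainPlant nz nx nu nw ny}
  {α : Type*} [MeasurableSpace α] {z : α → Fin nz → ℝ} {K : α → Matrix (Fin nu) (Fin nx) ℝ}

theorem measurable_closedLoopA_apply (hsys : sys.IsMeasurable) (hz : Measurable z)
    (hK : ∀ i j, Measurable fun a => K a i j) (i j : Fin nx) :
    Measurable fun a => sys.closedLoopA (z a) (K a) i j :=
  ((hsys.A i j).comp hz).add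
    (measurable_matrix_mul_apply (fun i j => (hsys.B i j).comp hz) hK i j)

theorem measurable_closedLoopC_apply (hsys : sys.IsMeasurable) (hz : Measurable z)
    (hK : ∀ i j, Measurable fun a => K a i j) (i : Fin ny) (j : Fin nx) :
    Measurable fun a => sys.closedLoopC (z a) (K a) i j :=
  ((hsys.C i j).comp hz).add
    (measurable_matrix_mul_apply (fun i j => (hsys.D i j).comp hz) hK i j)

theorem measurable_transfer_apply (hsys : sys.IsMeasurable) (hz : Measurable z)
    (hK : ∀ i j, Measurable fun a => K a i j) (i : Fin ny) (j : Fin nw) :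
    Measurable fun p : α × ℝ => sys.transfer (z p.1) (K p.1) (Complex.I * p.2) i j := by
  unfold transfer
  refine measurable_matrix_mul_apply (measurable_matrix_mul_apply (fun i j => ?_)
    (measurable_matrix_inv_apply fun i j => ?_)) (fun i j => ?_) i j
  · exact Complex.measurable_ofReal.comp
      ((measurable_closedLoopC_apply hsys hz hK i j).comp measurable_fst)
  · simp only [Matrix.sub_apply, Matrix.smul_apply, Matrix.map_apply, smul_eq_mul]
    refine Measurable.sub (by fun_prop) ?_
    exact Complex.measurable_ofReal.comp
      ((measurable_closedLoopA_apply hsys hz hK i j).comp measurable_fst)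
  · exact Complex.measurable_ofReal.comp (((hsys.E i j).comp hz).comp measurable_fst)

theorem measurable_h2Norm (hsys : sys.IsMeasurable) (hz : Measurable z)
    (hK : ∀ i j, Measurable fun a => K a i j) : Measurable fun a => sys.h2Norm (z a) (K a) := by
  have htr := measurable_transfer_apply hsys hz hK
  have hstable : MeasurableSet {a | sys.IsStable (z a) (K a)} :=
    measurableSet_setOf_spectrum_re_neg fun i j =>
      Complex.measurable_ofReal.comp (measurable_closedLoopA_apply hsys hz hK i j)
  unfold h2Norm
  refine Measurable.ite hstable (Measurable.pow_const (Measurable.const_mul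
    (Measurable.lintegral_prod_right' (f := fun p : α × ℝ => ENNReal.ofReal
        (Matrix.trace (sys.transfer (z p.1) (K p.1) (Complex.I * p.2)
          * (sys.transfer (z p.1) (K p.1) (Complex.I * p.2)).conjTranspose)).re) ?_) _) _)
    measurable_const
  refine (Complex.measurable_re.comp ?_).ennreal_ofReal
  simp only [Matrix.trace, Matrix.diag_apply]
  refine Finset.measurable_fun_sum _ fun i _ => measurable_matrix_mul_apply htr (fun i j => ?_) i i
  simp only [Matrix.conjTranspose_apply]
  exact continuous_star.measurable.comp (htr j i)

theorem measurable_maxH2_ofFn (hsys : sys.IsMeasurable) {k : ℕ} {t : α → Fin k → Fin nz → ℝ}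
    (ht : Measurable t) (hK : ∀ i j, Measurable fun a => K a i j) :
    Measurable fun a => sys.maxH2 (List.ofFn (t a)) (K a) := by
  induction k with
  | zero => simp [maxH2]
  | succ k ih =>
    simp only [List.ofFn_succ, maxH2, List.map_cons, List.foldr_cons]
    have hm : ∀ i, Measurable fun a => t a i := measurable_pi_iff.1 ht
    exact (measurable_h2Norm hsys (hm 0) hK).max
      (ih (t := fun a i => t a i.succ) (measurable_pi_lambda _ fun i => hm i.succ))

/-! ### Pick-to-Learn for `H₂` synthesis -/

section Synthesis

variable {solver : List (Fin nz → ℝ) → Option (Matrix (Fin nu) (Fin nx) ℝ)}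

theorem measurable_heldDecision_gain
    (hsolver : ∀ (k : ℕ) (i : Fin nu) (j : Fin nx),
      Measurable fun t : Fin k → (Fin nz → ℝ) => sys.synthGain solver (List.ofFn t) i j)
    (k : ℕ) (i : Fin nu) (j : Fin nx) :
    Measurable fun t : Fin k → (Fin nz → ℝ) =>
      (heldDecision (sys.synth solver) (0, 0) (List.ofFn t)).1 i j := by
  cases k with
  | zero => simp [heldDecision]
  | succ k => simpa [heldDecision, synth] using hsolver (k + 1) i j

theorem measurable_heldDecision_threshold (hsys : sys.IsMeasurable)
    (hsolver : ∀ (k : ℕ) (i : Fin nu) (j : Fin nx),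
      Measurable fun t : Fin k → (Fin nz → ℝ) => sys.synthGain solver (List.ofFn t) i j) (k : ℕ) :
    Measurable fun t : Fin k → (Fin nz → ℝ) =>
      (heldDecision (sys.synth solver) (0, 0) (List.ofFn t)).2 := by
  cases k with
  | zero => simp [heldDecision]
  | succ k =>
    simpa [heldDecision, synth] using measurable_maxH2_ofFn hsys measurable_id (hsolver (k + 1))

theorem isLinearOrder_dissatLE {tie : List (Fin nz → ℝ) → (Fin nz → ℝ) → (Fin nz → ℝ) → Prop}
    (T : List (Fin nz → ℝ)) (htie : IsLinearOrder (Fin nz → ℝ) (tie T))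
    (h : Matrix (Fin nu) (Fin nx) ℝ × ℝ≥0∞) :
    IsLinearOrder (Fin nz → ℝ) (sys.DissatLE tie T h) where
  refl a := Or.inr ⟨rfl, htie.toIsPartialOrder.toIsPreorder.toRefl.refl _⟩
  trans a b c := by
    rintro (h1 | ⟨h1, h1'⟩) (h2 | ⟨h2, h2'⟩)
    · exact Or.inl (h1.trans h2)
    · exact Or.inl (h1.trans_eq h2)
    · exact Or.inl (h1.trans_lt h2)
    · exact Or.inr ⟨h1.trans h2, htie.toIsPartialOrder.toIsPreorder.toIsTrans.trans _ _ _ h1' h2'⟩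
  antisymm a b := by
    rintro (h1 | ⟨h1, h1'⟩) (h2 | ⟨h2, h2'⟩)
    · exact absurd h2 h1.asymm
    · exact absurd h1 h2.not_gt
    · exact absurd h2 h1.not_gt
    · exact htie.toIsPartialOrder.toAntisymm.antisymm _ _ h1' h2'
  total a b := by
    rcases lt_trichotomy (sys.h2Norm a h.1) (sys.h2Norm b h.1) with h1 | h1 | h1
    · exact Or.inl (Or.inl h1)
    · exact (htie.toTotal.total a b).imp (fun h2 => Or.inr ⟨h1, h2⟩) fun h2 => Or.inr ⟨h1.symm, h2⟩
    · exact Or.inr (Or.inl h1)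

end Synthesis

end UncertainPlant

theorem corollary4 {nz nx nu nw ny N : ℕ}
    {Ω : Type*} [MeasurableSpace Ω] (P : Measure Ω) [IsProbabilityMeasure P]
    (Pz : Measure (Fin nz → ℝ)) [IsProbabilityMeasure Pz]
    -- the i.i.d. draws of the uncertainty parameter
    (z : Fin N → Ω → (Fin nz → ℝ)) (hz : ∀ i, Measurable (z i))
    (hlaw : ∀ i, P.map (z i) = Pz) (hindep : iIndepFun z P)
    -- the uncertain plant
    (sys : UncertainPlant nz nx nu nw ny) (hsys : sys.IsMeasurable)
    -- the numerical solver; the synthesized gain depends measurably on the data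
    (solver : List (Fin nz → ℝ) → Option (Matrix (Fin nu) (Fin nx) ℝ))
    (hsolver : ∀ (k : ℕ) (i : Fin nu) (j : Fin nx),
      Measurable fun t : Fin k → (Fin nz → ℝ) => sys.synthGain solver (List.ofFn t) i j)
    -- the tie-breaking rule, a measurable total order
    (tie : List (Fin nz → ℝ) → (Fin nz → ℝ) → (Fin nz → ℝ) → Prop)
    (htie : ∀ T, IsLinearOrder (Fin nz → ℝ) (tie T))
    (htie_meas : ∀ k : ℕ, MeasurableSet
      {p : (Fin k → (Fin nz → ℝ)) × (Fin nz → ℝ) × (Fin nz → ℝ) |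
        tie (List.ofFn p.1) p.2.1 p.2.2})
    -- the confidence parameter
    (δ : ℝ) (hδ0 : 0 < δ) (hδ1 : δ < 1) :
    MeasurableSet {ω : Ω |
      sys.risk Pz (sys.h2P2L solver tie (List.ofFn fun i => z i ω)).1 ≤
        ENNReal.ofReal
          (epsBar (sys.h2P2L solver tie (List.ofFn fun i => z i ω)).2.length δ N)} ∧
    ENNReal.ofReal (1 - δ) ≤ P {ω : Ω |
      sys.risk Pz (sys.h2P2L solver tie (List.ofFn fun i => z i ω)).1 ≤
        ENNReal.ofReal
          (epsBar (sys.h2P2L solver tie (List.ofFn fun i => z i ω)).2.length δ N)} := by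

  have hgain := UncertainPlant.measurable_heldDecision_gain hsolver
  have hthr := UncertainPlant.measurable_heldDecision_threshold hsys hsolver
  have hnot : ∀ h, sys.risk Pz h = Pz {x | ¬ sys.Sat h x} := fun h => by
    simp only [UncertainPlant.risk, UncertainPlant.Sat, not_le]
  simp only [hnot]
  refine p2l_risk_le_epsBar P Pz z hz hlaw hindep
    (fun T => UncertainPlant.isLinearOrder_dissatLE T (htie T) _) ?_ (fun k => ?_) (fun k => ?_)
    hδ0 hδ1
  · rintro T h x x' hle hx
    refine fun hx' => hx (le_trans ?_ hx')
    rcases hle with h1 | h1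
    · exact h1.le
    · exact h1.1.le
  · exact measurableSet_le
      (UncertainPlant.measurable_h2Norm hsys measurable_snd fun i j =>
        (hgain k i j).comp measurable_fst) ((hthr k).comp measurable_fst)
  · have h1 := UncertainPlant.measurable_h2Norm (α := (Fin k → Fin nz → ℝ) × _ × (Fin nz → ℝ))
      hsys (measurable_fst.comp measurable_snd) fun i j => (hgain k i j).comp measurable_fst
    have h2 := UncertainPlant.measurable_h2Norm (α := (Fin k → Fin nz → ℝ) × (Fin nz → ℝ) × _)
      hsys (measurable_snd.comp measurable_snd) fun i j => (hgain k i j).comp measurable_fst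
    exact (measurableSet_lt h1 h2).union ((measurableSet_eq_fun h1 h2).inter (htie_meas k))
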